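/- Let $m,n,p\ge 0$ be integers with $m+n\ge 1$. A system of type $(m,n,p)$ is a triple $(A,B,C)\in M_n(\mathbb C)\times M_{n\times m}(\mathbb C)\times M_{p\times n}(\mathbb C)$; it is completely controllable if the matrix $[\,B\ AB\ \cdots\ A^{n-1}B\,]$ has rank $n$. Let $V^{cc}_{m,n,p}$ be the Zariski open set of completely controllable systems and let $\mathrm{sys}^{cc}_{m,n,p}=V^{cc}_{m,n,p}/GL_n(\mathbb C)$ be the orbit variety (with the quotient Zariski topology and the invariant regular functions) for the action $g\cdot(A,B,C)=(gAg^{-1},gB,Cg^{-1})$. Let $N=m+n-1$. For an $n$-element subset $I\subset\{1,\dots,N\}$ let $S_I\subset \mathrm{Gras}_n(N)$ be the Schubert cell of all row spaces of $n\times N$ matrices of rank $n$ whose first $k$ columns span a space of dimension $\#(I\cap\{1,\dots,k\})$ for every $k\le N$; put $\ell(I)=\#\{(i,c): i\in I,\ c\notin I,\ i<c\}=\dim S_I$. By a cell decomposition of a variety we mean a finite partition into locally closed subvarieties (cells), each isomorphic to an affine space, such that the closure of every cell is the union of that cell and of cells of strictly smaller dimension. Then $\mathrm{sys}^{cc}_{m,n,p}$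 has a cell decomposition identical to the natural cell decomposition of a vector bundle of rank $n(p+1)$ over $\mathrm{Gras}_n(m+n-1)$ with respect to the Schubert cells. Precisely, there is a cell decomposition $\mathrm{sys}^{cc}_{m,n,p}=\bigsqcup_I C_I$, indexed by the $n$-element subsets $I\subset\{1,\dots,N\}$, with $C_I\cong\mathbb A^{\ell(I)+n(p+1)}$, such that for every algebraic vector bundle $\pi:E\to\mathrm{Gras}_n(N)$ of rank $n(p+1)$ that is trivial over each Schubert cell (and such bundles exist), the sets $\pi^{-1}(S_I)$ form a cell decomposition of $E$ with $\pi^{-1}(S_I)\cong\mathbb A^{\ell(I)+n(p+1)}$, and the two decompositions are identical: $C_I\cong\pi^{-1}(S_I)$ as varieties for every $I$, and, for all $I,J$, $C_J\subset\overline{C_I}$ if and only if $\pi^{-1}(S_J)\subset\overline{\pi^{-1}(S_I)}$. -/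

import Mathlib

open Set Topology

noncomputable section

/-! ## Complex spaces with functions

Classical complex varieties are treated as sets with a Zariski topology and a sheaf of
complex valued regular functions. The sheaf is recorded through the relation
`RegAt f x`: the function `f` is regular on some neighbourhood of `x`. -/

/-- A topological space with a sheaf of `ℂ`-algebras of `ℂ`-valued functions, such that the
non-vanishing locus of a regular function is open and its inverse is regular there. -/
structure SpaceWithFunctions (X : Type) where
  top : TopologicalSpace X
  RegAt : (X → ℂ) → X → Prop
  regAt_congr : ∀ (f g : X → ℂ) (x : X) (U : Set X), IsOpen[top] U → x ∈ U →
    (∀ y ∈ U, f y = g y) → RegAt f x → RegAt g x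
  regAt_nhds : ∀ (f : X → ℂ) (x : X), RegAt f x →
    ∃ U : Set X, IsOpen[top] U ∧ x ∈ U ∧ ∀ y ∈ U, RegAt f y
  regAt_const : ∀ (c : ℂ) (x : X), RegAt (fun _ => c) x
  regAt_add : ∀ (f g : X → ℂ) (x : X), RegAt f x → RegAt g x → RegAt (f + g) x
  regAt_mul : ∀ (f g : X → ℂ) (x : X), RegAt f x → RegAt g x → RegAt (f * g) x
  regAt_inv : ∀ (f : X → ℂ) (x : X), RegAt f x → f x ≠ 0 → RegAt f⁻¹ x
  regAt_ne_zero : ∀ (f : X → ℂ) (x : X), RegAt f x → f x ≠ 0 →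
    ∃ U : Set X, IsOpen[top] U ∧ x ∈ U ∧ ∀ y ∈ U, f y ≠ 0

namespace SpaceWithFunctions

/-- The closure of a subset. -/
def closure {X : Type} (𝒳 : SpaceWithFunctions X) (S : Set X) : Set X :=
  @_root_.closure X 𝒳.top S

/-- The functions that are regular on a set `U` (of interest when `U` is open). -/
def regOn {X : Type} (𝒳 : SpaceWithFunctions X) (U : Set X) : Subalgebra ℂ (X → ℂ) where
  carrier := {f | ∀ x ∈ U, 𝒳.RegAt f x}
  mul_mem' := fun {f g} hf hg x hx => 𝒳.regAt_mul f g x (hf x hx) (hg x hx)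
  add_mem' := fun {f g} hf hg x hx => 𝒳.regAt_add f g x (hf x hx) (hg x hx)
  algebraMap_mem' := fun c x _ => 𝒳.regAt_const c x

/-- Morphisms: continuous maps that pull regular functions back to regular functions. -/
def IsMorphism {X Y : Type} (𝒳 : SpaceWithFunctions X) (𝒴 : SpaceWithFunctions Y)
    (φ : X → Y) : Prop :=
  Continuous[𝒳.top, 𝒴.top] φ ∧
    ∀ (g : Y → ℂ) (x : X), 𝒴.RegAt g (φ x) → 𝒳.RegAt (g ∘ φ) x

/-- Isomorphisms: bijections that are morphisms in both directions. -/
structure Iso {X Y : Type} (𝒳 : SpaceWithFunctions X) (𝒴 : SpaceWithFunctions Y) where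
  toEquiv : X ≃ Y
  isMorphism : IsMorphism 𝒳 𝒴 toEquiv
  isMorphism_symm : IsMorphism 𝒴 𝒳 toEquiv.symm

/-- Affine space: the Zariski topology, whose basic open sets are the non-vanishing loci of
polynomials; regular functions are locally quotients of polynomials. -/
def affine (ι : Type) : SpaceWithFunctions (ι → ℂ) where
  top :=
    { IsOpen := fun U => ∀ x ∈ U, ∃ Q : MvPolynomial ι ℂ, MvPolynomial.eval x Q ≠ 0 ∧
        ∀ y, MvPolynomial.eval y Q ≠ 0 → y ∈ U
      isOpen_univ := fun _ _ => ⟨1, by simp, fun _ _ => mem_univ _⟩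
      isOpen_inter := by
        intro U V hU hV x hx
        obtain ⟨P, hP, hP'⟩ := hU x hx.1
        obtain ⟨Q, hQ, hQ'⟩ := hV x hx.2
        refine ⟨P * Q, by simp [hP, hQ], fun y hy => ?_⟩
        rw [map_mul] at hy
        exact ⟨hP' y (left_ne_zero_of_mul hy), hQ' y (right_ne_zero_of_mul hy)⟩
      isOpen_sUnion := by
        intro s hs x hx
        obtain ⟨U, hU, hxU⟩ := hx
        obtain ⟨Q, hQ, hQ'⟩ := hs U hU x hxU
        exact ⟨Q, hQ, fun y hy => ⟨U, hU, hQ' y hy⟩⟩ }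
  RegAt f x := ∃ P Q : MvPolynomial ι ℂ, MvPolynomial.eval x Q ≠ 0 ∧
    ∀ y, MvPolynomial.eval y Q ≠ 0 → f y = MvPolynomial.eval y P / MvPolynomial.eval y Q
  regAt_congr := by
    rintro f g x U hU hx hfg ⟨P, Q, hQ, h⟩
    obtain ⟨R, hR, hR'⟩ := hU x hx
    refine ⟨P * R, Q * R, by simp [hQ, hR], fun y hy => ?_⟩
    rw [map_mul] at hy
    have h1 := left_ne_zero_of_mul hy
    have h2 := right_ne_zero_of_mul hy
    rw [← hfg y (hR' y h2), h y h1, map_mul, map_mul]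
    field_simp
  regAt_nhds := by
    rintro f x ⟨P, Q, hQ, h⟩
    exact ⟨{y | MvPolynomial.eval y Q ≠ 0}, fun y hy => ⟨Q, hy, fun _ hz => hz⟩, hQ,
      fun y hy => ⟨P, Q, hy, h⟩⟩
  regAt_const c x := ⟨MvPolynomial.C c, 1, by simp, fun y _ => by simp⟩
  regAt_add := by
    rintro f g x ⟨P, Q, hQ, h⟩ ⟨P', Q', hQ', h'⟩
    refine ⟨P * Q' + P' * Q, Q * Q', by simp [hQ, hQ'], fun y hy => ?_⟩
    rw [map_mul] at hy
    have h1 := left_ne_zero_of_mul hy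
    have h2 := right_ne_zero_of_mul hy
    rw [Pi.add_apply, h y h1, h' y h2]
    simp only [map_mul, map_add]
    field_simp
  regAt_mul := by
    rintro f g x ⟨P, Q, hQ, h⟩ ⟨P', Q', hQ', h'⟩
    refine ⟨P * P', Q * Q', by simp [hQ, hQ'], fun y hy => ?_⟩
    rw [map_mul] at hy
    rw [Pi.mul_apply, h y (left_ne_zero_of_mul hy), h' y (right_ne_zero_of_mul hy)]
    simp only [map_mul]
    exact div_mul_div_comm _ _ _ _
  regAt_inv := by
    rintro f x ⟨P, Q, hQ, h⟩ hf
    have hP : MvPolynomial.eval x P ≠ 0 := by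
      intro h0
      exact hf (by rw [h x hQ, h0, zero_div])
    refine ⟨Q * Q, P * Q, by simp [hP, hQ], fun y hy => ?_⟩
    rw [map_mul] at hy
    have h1 := left_ne_zero_of_mul hy
    have h2 := right_ne_zero_of_mul hy
    rw [Pi.inv_apply, h y h2]
    simp only [map_mul]
    field_simp
  regAt_ne_zero := by
    rintro f x ⟨P, Q, hQ, h⟩ hf
    have hP : MvPolynomial.eval x P ≠ 0 := by
      intro h0
      exact hf (by rw [h x hQ, h0, zero_div])
    refine ⟨{y | MvPolynomial.eval y (P * Q) ≠ 0}, fun y hy => ⟨P * Q, hy, fun _ hz => hz⟩,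
      by simp [hP, hQ], fun y hy => ?_⟩
    rw [mem_ofPred_eq, map_mul] at hy
    rw [h y (right_ne_zero_of_mul hy)]
    exact div_ne_zero (left_ne_zero_of_mul hy) (right_ne_zero_of_mul hy)

/-- The structure induced along a map `j : Y → X`: the induced topology, with the functions that
are locally restrictions of regular functions. -/
def induced {X Y : Type} (𝒳 : SpaceWithFunctions X) (j : Y → X) : SpaceWithFunctions Y where
  top := TopologicalSpace.induced j 𝒳.top
  RegAt f y := ∃ (g : X → ℂ) (U : Set X), IsOpen[𝒳.top] U ∧ j y ∈ U ∧ 𝒳.RegAt g (j y) ∧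
    ∀ z, j z ∈ U → f z = g (j z)
  regAt_congr := by
    rintro f f' y V ⟨W, hW, rfl⟩ hy hff ⟨g, U, hU, hyU, hg, h⟩
    exact ⟨g, U ∩ W, @IsOpen.inter _ 𝒳.top _ _ hU hW, ⟨hyU, hy⟩, hg,
      fun z hz => by rw [← hff z hz.2, h z hz.1]⟩
  regAt_nhds := by
    rintro f y ⟨g, U, hU, hyU, hg, h⟩
    obtain ⟨V, hV, hyV, hgV⟩ := 𝒳.regAt_nhds g _ hg
    exact ⟨j ⁻¹' (U ∩ V), ⟨U ∩ V, @IsOpen.inter _ 𝒳.top _ _ hU hV, rfl⟩, ⟨hyU, hyV⟩,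
      fun z hz => ⟨g, U, hU, hz.1, hgV _ hz.2, h⟩⟩
  regAt_const c y := ⟨fun _ => c, univ, @isOpen_univ _ 𝒳.top, mem_univ _, 𝒳.regAt_const c _,
    fun _ _ => rfl⟩
  regAt_add := by
    rintro f f' y ⟨g, U, hU, hyU, hg, h⟩ ⟨g', U', hU', hyU', hg', h'⟩
    exact ⟨g + g', U ∩ U', @IsOpen.inter _ 𝒳.top _ _ hU hU', ⟨hyU, hyU'⟩,
      𝒳.regAt_add _ _ _ hg hg', fun z hz => by simp [h z hz.1, h' z hz.2]⟩
  regAt_mul := by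
    rintro f f' y ⟨g, U, hU, hyU, hg, h⟩ ⟨g', U', hU', hyU', hg', h'⟩
    exact ⟨g * g', U ∩ U', @IsOpen.inter _ 𝒳.top _ _ hU hU', ⟨hyU, hyU'⟩,
      𝒳.regAt_mul _ _ _ hg hg', fun z hz => by simp [h z hz.1, h' z hz.2]⟩
  regAt_inv := by
    rintro f y ⟨g, U, hU, hyU, hg, h⟩ hf
    exact ⟨g⁻¹, U, hU, hyU, 𝒳.regAt_inv _ _ hg (by rwa [← h y hyU]),
      fun z hz => by simp [h z hz]⟩
  regAt_ne_zero := by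
    rintro f y ⟨g, U, hU, hyU, hg, h⟩ hf
    obtain ⟨V, hV, hyV, hgV⟩ := 𝒳.regAt_ne_zero g _ hg (by rwa [← h y hyU])
    exact ⟨j ⁻¹' (U ∩ V), ⟨U ∩ V, @IsOpen.inter _ 𝒳.top _ _ hU hV, rfl⟩, ⟨hyU, hyV⟩,
      fun z hz => by rw [h z hz.1]; exact hgV _ hz.2⟩

/-- The structure on a subset. For a locally closed subset of a variety this is the reduced
locally closed subvariety. -/
def sub {X : Type} (𝒳 : SpaceWithFunctions X) (S : Set X) : SpaceWithFunctions S :=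
  𝒳.induced Subtype.val

/-- The quotient structure along a map `q : X → Y`: the quotient topology, and a function is
regular on an open set `V` if and only if its pullback is regular on `q ⁻¹' V`. -/
def coinduced {X Y : Type} (𝒳 : SpaceWithFunctions X) (q : X → Y) : SpaceWithFunctions Y where
  top := TopologicalSpace.coinduced q 𝒳.top
  RegAt f y := ∃ V : Set Y, IsOpen[𝒳.top] (q ⁻¹' V) ∧ y ∈ V ∧
    ∀ x, q x ∈ V → 𝒳.RegAt (f ∘ q) x
  regAt_congr := by
    rintro f g y U hU hy hfg ⟨V, hV, hyV, h⟩
    exact ⟨V ∩ U, @IsOpen.inter _ 𝒳.top _ _ hV hU, ⟨hyV, hy⟩, fun x hx =>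
      𝒳.regAt_congr (f ∘ q) _ x _ hU hx.2 (fun z hz => hfg _ hz) (h x hx.1)⟩
  regAt_nhds := by
    rintro f y ⟨V, hV, hyV, h⟩
    exact ⟨V, hV, hyV, fun z hz => ⟨V, hV, hz, h⟩⟩
  regAt_const c y := ⟨univ, @isOpen_univ _ 𝒳.top, mem_univ _, fun x _ => 𝒳.regAt_const c x⟩
  regAt_add := by
    rintro f g y ⟨V, hV, hyV, h⟩ ⟨V', hV', hyV', h'⟩
    exact ⟨V ∩ V', @IsOpen.inter _ 𝒳.top _ _ hV hV', ⟨hyV, hyV'⟩, fun x hx =>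
      𝒳.regAt_add _ _ _ (h x hx.1) (h' x hx.2)⟩
  regAt_mul := by
    rintro f g y ⟨V, hV, hyV, h⟩ ⟨V', hV', hyV', h'⟩
    exact ⟨V ∩ V', @IsOpen.inter _ 𝒳.top _ _ hV hV', ⟨hyV, hyV'⟩, fun x hx =>
      𝒳.regAt_mul _ _ _ (h x hx.1) (h' x hx.2)⟩
  regAt_inv := by
    rintro f y ⟨V, hV, hyV, h⟩ hf
    refine ⟨V ∩ {z | f z ≠ 0}, ?_, ⟨hyV, hf⟩, fun x hx => 𝒳.regAt_inv _ _ (h x hx.1) hx.2⟩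
    refine (@isOpen_iff_forall_mem_open _ 𝒳.top _).2 fun x hx => ?_
    obtain ⟨U, hU, hxU, hne⟩ := 𝒳.regAt_ne_zero _ x (h x hx.1) hx.2
    exact ⟨U ∩ q ⁻¹' V, fun z hz => ⟨hz.2, hne z hz.1⟩, @IsOpen.inter _ 𝒳.top _ _ hU hV,
      ⟨hxU, hx.1⟩⟩
  regAt_ne_zero := by
    rintro f y ⟨V, hV, hyV, h⟩ hf
    refine ⟨V ∩ {z | f z ≠ 0}, ?_, ⟨hyV, hf⟩, fun x hx => hx.2⟩
    refine (@isOpen_iff_forall_mem_open _ 𝒳.top _).2 fun x hx => ?_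
    obtain ⟨U, hU, hxU, hne⟩ := 𝒳.regAt_ne_zero _ x (h x hx.1) hx.2
    exact ⟨U ∩ q ⁻¹' V, fun z hz => ⟨hz.2, hne z hz.1⟩, @IsOpen.inter _ 𝒳.top _ _ hU hV,
      ⟨hxU, hx.1⟩⟩

/-- The functions `(x, y) ↦ ∑ fᵢ(x) gᵢ(y)` (finite sums), with all `fᵢ` regular on `U` and all
`gᵢ` regular on `V`. -/
def tensorOn {X Y : Type} (𝒳 : SpaceWithFunctions X) (𝒴 : SpaceWithFunctions Y)
    (U : Set X) (V : Set Y) : Subalgebra ℂ (X × Y → ℂ) :=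
  Algebra.adjoin ℂ ({F | ∃ f ∈ 𝒳.regOn U, F = fun z => f z.1} ∪
    {F | ∃ g ∈ 𝒴.regOn V, F = fun z => g z.2})

theorem tensorOn_mono {X Y : Type} (𝒳 : SpaceWithFunctions X) (𝒴 : SpaceWithFunctions Y)
    {U U' : Set X} {V V' : Set Y} (hU : U' ⊆ U) (hV : V' ⊆ V) :
    𝒳.tensorOn 𝒴 U V ≤ 𝒳.tensorOn 𝒴 U' V' := by
  refine Algebra.adjoin_mono (union_subset_union ?_ ?_)
  · rintro F ⟨f, hf, rfl⟩
    exact ⟨f, fun x hx => hf x (hU hx), rfl⟩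
  · rintro F ⟨f, hf, rfl⟩
    exact ⟨f, fun x hx => hf x (hV hx), rfl⟩

/-- The topology of the product of two varieties: its basic open sets are the loci
`Q ≠ 0` in `U ×ˢ V`, where `Q = ∑ fᵢ(x) gᵢ(y)` with `fᵢ` regular on `U` and `gᵢ` on `V`. -/
abbrev prodTop {X Y : Type} (𝒳 : SpaceWithFunctions X) (𝒴 : SpaceWithFunctions Y) :
    TopologicalSpace (X × Y) where
  IsOpen W := ∀ z ∈ W, ∃ (U : Set X) (V : Set Y), IsOpen[𝒳.top] U ∧ IsOpen[𝒴.top] V ∧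
    z ∈ U ×ˢ V ∧ ∃ Q ∈ 𝒳.tensorOn 𝒴 U V, Q z ≠ 0 ∧ ∀ w ∈ U ×ˢ V, Q w ≠ 0 → w ∈ W
  isOpen_univ z _ := ⟨univ, univ, @isOpen_univ _ 𝒳.top, @isOpen_univ _ 𝒴.top, by simp,
    1, one_mem _, by simp, fun _ _ _ => mem_univ _⟩
  isOpen_inter := by
    intro W W' hW hW' z hz
    obtain ⟨U, V, hU, hV, hzUV, Q, hQ, hQz, h⟩ := hW z hz.1
    obtain ⟨U', V', hU', hV', hzUV', Q', hQ', hQz', h'⟩ := hW' z hz.2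
    refine ⟨U ∩ U', V ∩ V', @IsOpen.inter _ 𝒳.top _ _ hU hU', @IsOpen.inter _ 𝒴.top _ _ hV hV',
      ⟨⟨hzUV.1, hzUV'.1⟩, ⟨hzUV.2, hzUV'.2⟩⟩, Q * Q',
      mul_mem (tensorOn_mono 𝒳 𝒴 inter_subset_left inter_subset_left hQ)
        (tensorOn_mono 𝒳 𝒴 inter_subset_right inter_subset_right hQ'),
      mul_ne_zero hQz hQz', fun w hw hne => ?_⟩
    exact ⟨h w ⟨hw.1.1, hw.2.1⟩ (left_ne_zero_of_mul hne),
      h' w ⟨hw.1.2, hw.2.2⟩ (right_ne_zero_of_mul hne)⟩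
  isOpen_sUnion := by
    intro s hs z hz
    obtain ⟨W, hW, hzW⟩ := hz
    obtain ⟨U, V, hU, hV, hzUV, Q, hQ, hQz, h⟩ := hs W hW z hzW
    exact ⟨U, V, hU, hV, hzUV, Q, hQ, hQz, fun w hw hne => ⟨W, hW, h w hw hne⟩⟩

theorem isOpen_prod_basic {X Y : Type} (𝒳 : SpaceWithFunctions X) (𝒴 : SpaceWithFunctions Y)
    {U : Set X} {V : Set Y} (hU : IsOpen[𝒳.top] U) (hV : IsOpen[𝒴.top] V) {Q : X × Y → ℂ}
    (hQ : Q ∈ 𝒳.tensorOn 𝒴 U V) :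
    IsOpen[𝒳.prodTop 𝒴] {w | w ∈ U ×ˢ V ∧ Q w ≠ 0} :=
  fun _ hz => ⟨U, V, hU, hV, hz.1, Q, hQ, hz.2, fun _ hw hne => ⟨hw, hne⟩⟩

/-- The product of two varieties; a function is regular if it is locally a quotient of two
functions of the form `∑ fᵢ(x) gᵢ(y)`, with `fᵢ` and `gᵢ` regular. -/
def prod {X Y : Type} (𝒳 : SpaceWithFunctions X) (𝒴 : SpaceWithFunctions Y) :
    SpaceWithFunctions (X × Y) where
  top := 𝒳.prodTop 𝒴
  RegAt F z := ∃ (U : Set X) (V : Set Y), IsOpen[𝒳.top] U ∧ IsOpen[𝒴.top] V ∧ z ∈ U ×ˢ V ∧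
    ∃ P ∈ 𝒳.tensorOn 𝒴 U V, ∃ Q ∈ 𝒳.tensorOn 𝒴 U V, Q z ≠ 0 ∧
      ∀ w ∈ U ×ˢ V, Q w ≠ 0 → F w = P w / Q w
  regAt_congr := by
    rintro F G z W hW hz hFG ⟨U, V, hU, hV, hzUV, P, hP, Q, hQ, hQz, h⟩
    obtain ⟨U', V', hU', hV', hzUV', R, hR, hRz, h'⟩ := hW z hz
    have hR1 := tensorOn_mono 𝒳 𝒴 (inter_subset_right (s := U)) (inter_subset_right (s := V)) hR
    have hP1 := tensorOn_mono 𝒳 𝒴 (inter_subset_left (t := U')) (inter_subset_left (t := V')) hP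
    have hQ1 := tensorOn_mono 𝒳 𝒴 (inter_subset_left (t := U')) (inter_subset_left (t := V')) hQ
    refine ⟨U ∩ U', V ∩ V', @IsOpen.inter _ 𝒳.top _ _ hU hU', @IsOpen.inter _ 𝒴.top _ _ hV hV',
      ⟨⟨hzUV.1, hzUV'.1⟩, ⟨hzUV.2, hzUV'.2⟩⟩, P * R, mul_mem hP1 hR1, Q * R, mul_mem hQ1 hR1,
      mul_ne_zero hQz hRz, fun w hw hne => ?_⟩
    have h1 : Q w ≠ 0 := left_ne_zero_of_mul hne
    have h2 : R w ≠ 0 := right_ne_zero_of_mul hne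
    rw [← hFG w (h' w ⟨hw.1.2, hw.2.2⟩ h2), h w ⟨hw.1.1, hw.2.1⟩ h1, Pi.mul_apply, Pi.mul_apply]
    field_simp
  regAt_nhds := by
    rintro F z ⟨U, V, hU, hV, hzUV, P, hP, Q, hQ, hQz, h⟩
    exact ⟨{w | w ∈ U ×ˢ V ∧ Q w ≠ 0}, isOpen_prod_basic 𝒳 𝒴 hU hV hQ, ⟨hzUV, hQz⟩,
      fun w hw => ⟨U, V, hU, hV, hw.1, P, hP, Q, hQ, hw.2, h⟩⟩
  regAt_const c z := ⟨univ, univ, @isOpen_univ _ 𝒳.top, @isOpen_univ _ 𝒴.top, by simp,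
    fun _ => c, (𝒳.tensorOn 𝒴 univ univ).algebraMap_mem c, 1, one_mem _, by simp,
    fun _ _ _ => by simp⟩
  regAt_add := by
    rintro F G z ⟨U, V, hU, hV, hzUV, P, hP, Q, hQ, hQz, h⟩
      ⟨U', V', hU', hV', hzUV', P', hP', Q', hQ', hQz', h'⟩
    have hP1 := tensorOn_mono 𝒳 𝒴 (inter_subset_left (t := U')) (inter_subset_left (t := V')) hP
    have hQ1 := tensorOn_mono 𝒳 𝒴 (inter_subset_left (t := U')) (inter_subset_left (t := V')) hQ
    have hP2 := tensorOn_mono 𝒳 𝒴 (inter_subset_right (s := U)) (inter_subset_right (s := V)) hP'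
    have hQ2 := tensorOn_mono 𝒳 𝒴 (inter_subset_right (s := U)) (inter_subset_right (s := V)) hQ'
    refine ⟨U ∩ U', V ∩ V', @IsOpen.inter _ 𝒳.top _ _ hU hU', @IsOpen.inter _ 𝒴.top _ _ hV hV',
      ⟨⟨hzUV.1, hzUV'.1⟩, ⟨hzUV.2, hzUV'.2⟩⟩, P * Q' + P' * Q,
      add_mem (mul_mem hP1 hQ2) (mul_mem hP2 hQ1), Q * Q', mul_mem hQ1 hQ2,
      mul_ne_zero hQz hQz', fun w hw hne => ?_⟩
    have h1 : Q w ≠ 0 := left_ne_zero_of_mul hne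
    have h2 : Q' w ≠ 0 := right_ne_zero_of_mul hne
    rw [Pi.add_apply, h w ⟨hw.1.1, hw.2.1⟩ h1, h' w ⟨hw.1.2, hw.2.2⟩ h2]
    simp only [Pi.add_apply, Pi.mul_apply]
    field_simp
  regAt_mul := by
    rintro F G z ⟨U, V, hU, hV, hzUV, P, hP, Q, hQ, hQz, h⟩
      ⟨U', V', hU', hV', hzUV', P', hP', Q', hQ', hQz', h'⟩
    have hP1 := tensorOn_mono 𝒳 𝒴 (inter_subset_left (t := U')) (inter_subset_left (t := V')) hP
    have hQ1 := tensorOn_mono 𝒳 𝒴 (inter_subset_left (t := U')) (inter_subset_left (t := V')) hQ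
    have hP2 := tensorOn_mono 𝒳 𝒴 (inter_subset_right (s := U)) (inter_subset_right (s := V)) hP'
    have hQ2 := tensorOn_mono 𝒳 𝒴 (inter_subset_right (s := U)) (inter_subset_right (s := V)) hQ'
    refine ⟨U ∩ U', V ∩ V', @IsOpen.inter _ 𝒳.top _ _ hU hU', @IsOpen.inter _ 𝒴.top _ _ hV hV',
      ⟨⟨hzUV.1, hzUV'.1⟩, ⟨hzUV.2, hzUV'.2⟩⟩, P * P', mul_mem hP1 hP2, Q * Q', mul_mem hQ1 hQ2,
      mul_ne_zero hQz hQz', fun w hw hne => ?_⟩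
    rw [Pi.mul_apply, h w ⟨hw.1.1, hw.2.1⟩ (left_ne_zero_of_mul hne),
      h' w ⟨hw.1.2, hw.2.2⟩ (right_ne_zero_of_mul hne)]
    exact div_mul_div_comm _ _ _ _
  regAt_inv := by
    rintro F z ⟨U, V, hU, hV, hzUV, P, hP, Q, hQ, hQz, h⟩ hF
    have hPz : P z ≠ 0 := by
      intro h0
      exact hF (by rw [h z hzUV hQz, h0, zero_div])
    refine ⟨U, V, hU, hV, hzUV, Q * Q, mul_mem hQ hQ, P * Q, mul_mem hP hQ,
      mul_ne_zero hPz hQz, fun w hw hne => ?_⟩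
    have h1 : P w ≠ 0 := left_ne_zero_of_mul hne
    have h2 : Q w ≠ 0 := right_ne_zero_of_mul hne
    rw [Pi.inv_apply, h w hw h2, Pi.mul_apply, Pi.mul_apply]
    field_simp
  regAt_ne_zero := by
    rintro F z ⟨U, V, hU, hV, hzUV, P, hP, Q, hQ, hQz, h⟩ hF
    have hPz : P z ≠ 0 := by
      intro h0
      exact hF (by rw [h z hzUV hQz, h0, zero_div])
    refine ⟨{w | w ∈ U ×ˢ V ∧ (P * Q) w ≠ 0}, isOpen_prod_basic 𝒳 𝒴 hU hV (mul_mem hP hQ),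
      ⟨hzUV, mul_ne_zero hPz hQz⟩, fun w hw => ?_⟩
    rw [h w hw.1 (right_ne_zero_of_mul hw.2)]
    exact div_ne_zero (left_ne_zero_of_mul hw.2) (right_ne_zero_of_mul hw.2)

/-! ## Cell decompositions -/

/-- The finitely many pieces `C j` form an (algebraic) cell decomposition of the space, with cell
`C j` of complex dimension `d j`: they are locally closed, they partition the space, each `C j` is
isomorphic to the affine space of dimension `d j`, and the closure of each cell is the union of
that cell and of cells of smaller dimension. -/
structure IsCellDecomposition {X J : Type} [Finite J] (𝒳 : SpaceWithFunctions X)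
    (C : J → Set X) (d : J → ℕ) : Prop where
  disjoint : ∀ i j, i ≠ j → Disjoint (C i) (C j)
  cover : ⋃ j, C j = univ
  locallyClosed : ∀ j, @IsLocallyClosed X 𝒳.top (C j)
  cell : ∀ j, Nonempty (Iso (𝒳.sub (C j)) (affine (Fin (d j))))
  closure_union : ∀ i j, (C i ∩ 𝒳.closure (C j)).Nonempty → C i ⊆ 𝒳.closure (C j)
  dim_lt : ∀ i j, i ≠ j → C i ⊆ 𝒳.closure (C j) → d i < d j

/-- Two decompositions with the same index set are identical: corresponding cells are isomorphic
varieties, and the closure relations between the cells are the same. -/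
def IdenticalCells {X Y J : Type} (𝒳 : SpaceWithFunctions X) (C : J → Set X)
    (𝒴 : SpaceWithFunctions Y) (D : J → Set Y) : Prop :=
  (∀ j, Nonempty (Iso (𝒳.sub (C j)) (𝒴.sub (D j)))) ∧
    ∀ i j, C i ⊆ 𝒳.closure (C j) ↔ D i ⊆ 𝒴.closure (D j)

end SpaceWithFunctions

open SpaceWithFunctions

/-! ## Algebraic vector bundles -/

/-- A family of complex vector spaces over `B` whose total space carries a variety structure. -/
structure VectorFamily (B : Type) where
  Fiber : B → Type
  [addCommGroup : ∀ b, AddCommGroup (Fiber b)]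
  [module : ∀ b, Module ℂ (Fiber b)]
  total : SpaceWithFunctions (Σ b, Fiber b)

attribute [instance] VectorFamily.addCommGroup VectorFamily.module

namespace VectorFamily

/-- The part of the total space lying over `S`. -/
def part {B : Type} (E : VectorFamily B) (S : Set B) : Set (Σ b, E.Fiber b) :=
  {z | z.1 ∈ S}

/-- The restriction of the family to `S` is isomorphic to the trivial bundle `S × 𝔸ʳ`, through an
isomorphism over `S` that is linear on the fibres. -/
def IsTrivialOver {B : Type} (𝓑 : SpaceWithFunctions B) (r : ℕ) (E : VectorFamily B)
    (S : Set B) : Prop :=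
  ∃ e : Iso (E.total.sub (E.part S)) ((𝓑.sub S).prod (affine (Fin r))),
    (∀ z, (e.toEquiv z).1.1 = z.1.1) ∧
    ∀ (b : B) (hb : b ∈ S), IsLinearMap ℂ fun v : E.Fiber b => (e.toEquiv ⟨⟨b, v⟩, hb⟩).2

/-- Algebraic vector bundles of rank `r`: the projection to the base is a morphism, and the family
is locally trivial. -/
def IsVectorBundle {B : Type} (𝓑 : SpaceWithFunctions B) (r : ℕ) (E : VectorFamily B) : Prop :=
  IsMorphism E.total 𝓑 Sigma.fst ∧
    ∀ b : B, ∃ U : Set B, IsOpen[𝓑.top] U ∧ b ∈ U ∧ E.IsTrivialOver 𝓑 r U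

end VectorFamily

/-! ## Linear systems -/

/-- The triples `(A, B, C)` of complex matrices of sizes `n × n`, `n × m`, `p × n`. -/
structure LinearSystem (m n p : ℕ) where
  A : Matrix (Fin n) (Fin n) ℂ
  B : Matrix (Fin n) (Fin m) ℂ
  C : Matrix (Fin p) (Fin n) ℂ

namespace LinearSystem

/-- The matrix entries of a system, as a point of affine space. -/
def coords {m n p : ℕ} (S : LinearSystem m n p) :
    (Fin n × Fin n) ⊕ (Fin n × Fin m) ⊕ (Fin p × Fin n) → ℂ
  | Sum.inl (i, j) => S.A i j
  | Sum.inr (Sum.inl (i, j)) => S.B i j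
  | Sum.inr (Sum.inr (i, j)) => S.C i j

/-- The matrix `[B  AB  A²B  ⋯  Aⁿ⁻¹B]`; its column with index `(i, j)` is the `j`-th column
of `Aⁱ B`. -/
def controlMatrix {m n p : ℕ} (S : LinearSystem m n p) :
    Matrix (Fin n) (Fin n × Fin m) ℂ :=
  Matrix.of fun r c => (S.A ^ (c.1 : ℕ) * S.B) r c.2

/-- Complete controllability: the control matrix has rank `n`. -/
def IsCompletelyControllable {m n p : ℕ} (S : LinearSystem m n p) : Prop :=
  S.controlMatrix.rank = n

/-- Equivalence of systems: base change in the state space. -/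
def Equivalent {m n p : ℕ} (S S' : LinearSystem m n p) : Prop :=
  ∃ g : GL (Fin n) ℂ,
    S'.A = (g : Matrix (Fin n) (Fin n) ℂ) * S.A *
      ((g⁻¹ : GL (Fin n) ℂ) : Matrix (Fin n) (Fin n) ℂ) ∧
    S'.B = (g : Matrix (Fin n) (Fin n) ℂ) * S.B ∧
    S'.C = S.C * ((g⁻¹ : GL (Fin n) ℂ) : Matrix (Fin n) (Fin n) ℂ)

end LinearSystem

/-- The completely controllable systems. -/
abbrev CCSystem (m n p : ℕ) : Type :=
  {S : LinearSystem m n p // S.IsCompletelyControllable}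

/-- Completely controllable systems as an open subvariety of the affine space of all systems. -/
def ccSystemStr (m n p : ℕ) : SpaceWithFunctions (CCSystem m n p) :=
  (affine ((Fin n × Fin n) ⊕ (Fin n × Fin m) ⊕ (Fin p × Fin n))).induced fun S => S.1.coords

/-- Equivalence of completely controllable systems. -/
def ccSetoid (m n p : ℕ) : Setoid (CCSystem m n p) where
  r S S' := S.1.Equivalent S'.1
  iseqv :=
    { refl := fun S => ⟨1, by simp, by simp, by simp⟩
      symm := by
        rintro S S' ⟨g, hA, hB, hC⟩
        have h : ((g⁻¹ : GL (Fin n) ℂ) : Matrix (Fin n) (Fin n) ℂ) * g = 1 := by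
          rw [← Units.val_mul, inv_mul_cancel, Units.val_one]
        refine ⟨g⁻¹, ?_, ?_, ?_⟩
        · rw [hA, inv_inv, Matrix.mul_assoc, Matrix.mul_assoc, Matrix.mul_assoc, h,
            Matrix.mul_one, ← Matrix.mul_assoc, h, Matrix.one_mul]
        · rw [hB, ← Matrix.mul_assoc, h, Matrix.one_mul]
        · rw [hC, inv_inv, Matrix.mul_assoc, h, Matrix.mul_one]
      trans := by
        rintro S S' S'' ⟨g, hA, hB, hC⟩ ⟨g', hA', hB', hC'⟩
        refine ⟨g' * g, ?_, ?_, ?_⟩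
        · rw [hA', hA]
          simp only [mul_inv_rev, Units.val_mul, Matrix.mul_assoc]
        · rw [hB', hB]
          simp only [Units.val_mul, Matrix.mul_assoc]
        · rw [hC', hC]
          simp only [mul_inv_rev, Units.val_mul, Matrix.mul_assoc] }

/-- The moduli space of completely controllable systems, as a set: the orbit space. -/
def SysCC (m n p : ℕ) : Type := Quotient (ccSetoid m n p)

/-- The moduli space of completely controllable systems, as a variety: the quotient structure
(quotient topology, and invariant regular functions). -/
def sysCC (m n p : ℕ) : SpaceWithFunctions (SysCC m n p) :=
  (ccSystemStr m n p).coinduced (Quotient.mk (ccSetoid m n p))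

/-! ## Grassmannians and Schubert cells -/

/-- The Grassmannian of `n`-dimensional subspaces of `ℂᴺ`, as a set. -/
def Gras (n N : ℕ) : Type := {W : Submodule ℂ (Fin N → ℂ) // Module.finrank ℂ W = n}

/-- The `n × N` matrices of rank `n`, given by their linearly independent rows. -/
abbrev FullRankMatrix (n N : ℕ) : Type :=
  {M : Matrix (Fin n) (Fin N) ℂ // LinearIndependent ℂ fun i => M i}

/-- The row space of a matrix of full rank. Two such matrices have the same row space if and only
if they lie in the same orbit of `GLₙ`. -/
def rowSpace {n N : ℕ} (M : FullRankMatrix n N) : Gras n N :=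
  ⟨Submodule.span ℂ (range fun i => M.1 i), by
    rw [finrank_span_eq_card M.2, Fintype.card_fin]⟩

/-- The Grassmannian as a variety: the quotient of the open set of `n × N` matrices of rank `n`
by the left action of `GLₙ`. -/
def gras (n N : ℕ) : SpaceWithFunctions (Gras n N) :=
  ((affine (Fin n × Fin N)).induced
    fun (M : FullRankMatrix n N) (ij : Fin n × Fin N) => M.1 ij.1 ij.2).coinduced rowSpace

/-- Multi-indices `d₁ < ⋯ < dₙ` in an `N`-element set. -/
abbrev MultiIndex (n N : ℕ) : Type := {I : Finset (Fin N) // I.card = n}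

/-- The Schubert cell of the multi-index `I`, for the standard coordinate flag: the subspaces `W`
such that, for every `k`, the projection of `W` to the first `k` coordinates has dimension
`#(I ∩ {first k indices})`. If `W` is the row space of `M`, this dimension is the
dimension of the span of the first `k` columns of `M`. -/
def schubertCell {n N : ℕ} (I : MultiIndex n N) : Set (Gras n N) :=
  {W | ∀ k : ℕ, k ≤ N →
    Module.finrank ℂ (W.1.map (LinearMap.funLeft ℂ ℂ
      (Subtype.val : {j : Fin N // (j : ℕ) < k} → Fin N))) =
    (I.1.filter fun j : Fin N => (j : ℕ) < k).card}

/-- The dimension of the Schubert cell: the number of pairs `i < c` with `i ∈ I` and `c ∉ I`. -/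
def schubertDim {n N : ℕ} (I : MultiIndex n N) : ℕ :=
  ∑ c ∈ I.1ᶜ, (I.1.filter fun i => i < c).card

end

/-!
Both decompositions are stratifications by a rank function, that is by a sequence of dimensions
`ρ₀ ≤ ρ₁ ≤ ⋯ ≤ n` that depends lower semicontinuously on the point. On the Grassmannian, `ρₖ` is the
rank of the first `k` columns. On the moduli space of systems, `ρₖ` is the dimension of the
`A`-invariant subspace generated by the first `k` columns of `B`; the last one is `n` by
controllability.

A multi-index `i₀ < ⋯ < iₙ₋₁` in `{0, …, m + n - 2}` is the same thing as a weakly increasing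
sequence `aₛ = iₛ - s` with values in `{0, …, m - 1}`. The Schubert cell of `I` is the stratum with
`ρₖ = #{s | iₛ < k}`, and its cell in the moduli space is the stratum with `ρₖ = #{s | aₛ < k}`.
Ranks can only drop in a limit, so a point in the closure of the `I`-stratum lies in a `J`-stratum
with `iₛ(I) ≤ iₛ(J)` for all `s`, equivalently with `aₛ(I) ≤ aₛ(J)` for all `s`. Hence the closure
relations agree as soon as each stratum is shown to lie in the closure of all the larger ones
(`isCellDecomposition_rankStratum`, `rankStratum_subset_closure_iff`).

For this, a point of the smaller stratum is represented by a point of a linear space of matrices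
whose generic elements lie in the larger stratum (`mem_closure_induced`). For Schubert cells these
are the matrices with zeros to the left of the positions in `I`, and the representative is the
reduced echelon matrix (`schubertCell_subset_closure`). For systems these are the pairs `(A, B)`
that respect the coordinate flag of `I`, and the representative is a triangular form of the system,
which comes from a complete `A`-invariant flag through the reachable subspaces (`exists_triangular`,
`sysCell_subset_closure`).

That a stratum is an affine space is seen on normal forms. In a Schubert cell it is the reduced
echelon form (`schubertCellIso`). For a system in the cell of `I`, the vectors `Aᵒ bⱼ` with `o`
less than the number `dⱼ` of indices `s` with `aₛ = j` form a basis, by a dimension count; in this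
basis all entries of `A` and `B` are `0` or `1`, except the coefficients of the vectors `A^dⱼ bⱼ`,
which lie in the span of the blocks up to the `j`-th one, and `C` is arbitrary (`sysCellIso`). The
normal form is a regular function of the orbit on the open set where the selected vectors are
independent, so this is an isomorphism of varieties.

A vector bundle that is trivial over the Schubert cells is handled by its projection, which is a
continuous open map (`isOpen_image_proj`), so that forming closures commutes with preimages; the
product of varieties is used through its universal property (`isMorphism_prod`). The trivial bundle
is an example of such a bundle.
-/

noncomputable section

/-! ### Morphisms and isomorphisms -/

namespace SpaceWithFunctions

variable {X Y Z : Type} {𝒳 : SpaceWithFunctions X} {𝒴 : SpaceWithFunctions Y}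
  {𝒵 : SpaceWithFunctions Z}

theorem IsMorphism.comp {ψ : Y → Z} {φ : X → Y} (hψ : IsMorphism 𝒴 𝒵 ψ)
    (hφ : IsMorphism 𝒳 𝒴 φ) : IsMorphism 𝒳 𝒵 (ψ ∘ φ) :=
  ⟨@Continuous.comp _ _ _ 𝒳.top 𝒴.top 𝒵.top _ _ hψ.1 hφ.1,
    fun g x hg => hφ.2 (g ∘ ψ) x (hψ.2 g (φ x) hg)⟩

theorem isMorphism_id : IsMorphism 𝒳 𝒳 id :=
  ⟨@continuous_id _ 𝒳.top, fun _ _ hg => hg⟩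

theorem isMorphism_const (y : Y) : IsMorphism 𝒳 𝒴 fun _ => y :=
  ⟨@continuous_const _ _ 𝒳.top 𝒴.top y, fun g x _ => 𝒳.regAt_const (g y) x⟩

theorem IsMorphism.isOpen_preimage {φ : X → Y} (hφ : IsMorphism 𝒳 𝒴 φ) {U : Set Y}
    (hU : IsOpen[𝒴.top] U) : IsOpen[𝒳.top] (φ ⁻¹' U) :=
  (@continuous_def _ _ 𝒳.top 𝒴.top φ).1 hφ.1 U hU

theorem IsMorphism.of_isOpen_preimage {φ : X → Y}
    (h : ∀ U, IsOpen[𝒴.top] U → IsOpen[𝒳.top] (φ ⁻¹' U))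
    (h' : ∀ (g : Y → ℂ) (x : X), 𝒴.RegAt g (φ x) → 𝒳.RegAt (g ∘ φ) x) : IsMorphism 𝒳 𝒴 φ :=
  ⟨(@continuous_def _ _ 𝒳.top 𝒴.top φ).2 h, h'⟩

/-- Composition of isomorphisms. -/
def Iso.trans (e : Iso 𝒳 𝒴) (f : Iso 𝒴 𝒵) : Iso 𝒳 𝒵 where
  toEquiv := e.toEquiv.trans f.toEquiv
  isMorphism := f.isMorphism.comp e.isMorphism
  isMorphism_symm := e.isMorphism_symm.comp f.isMorphism_symm

/-- The inverse of an isomorphism. -/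
def Iso.symm (e : Iso 𝒳 𝒴) : Iso 𝒴 𝒳 where
  toEquiv := e.toEquiv.symm
  isMorphism := e.isMorphism_symm
  isMorphism_symm := e.isMorphism

/-! ### Regular functions -/

theorem isOpen_ne_zero {f : X → ℂ} (hf : f ∈ 𝒳.regOn univ) :
    IsOpen[𝒳.top] {x | f x ≠ 0} :=
  (@isOpen_iff_forall_mem_open _ 𝒳.top _).2 fun x hx =>
    let ⟨U, hU, hxU, h⟩ := 𝒳.regAt_ne_zero f x (hf x (mem_univ x)) hx
    ⟨U, h, hU, hxU⟩

theorem IsMorphism.comp_mem_regOn {φ : X → Y} (hφ : IsMorphism 𝒳 𝒴 φ) {f : Y → ℂ}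
    (hf : f ∈ 𝒴.regOn univ) : f ∘ φ ∈ 𝒳.regOn univ :=
  fun x _ => hφ.2 f x (hf _ (mem_univ _))

theorem sum_mem_regOn {α : Type} (s : Finset α) (U : Set X) (f : α → X → ℂ)
    (h : ∀ i ∈ s, f i ∈ 𝒳.regOn U) : (fun x => ∑ i ∈ s, f i x) ∈ 𝒳.regOn U := by
  have := sum_mem h
  convert this using 1
  ext x
  simp

theorem prod_mem_regOn {α : Type} (s : Finset α) (U : Set X) (f : α → X → ℂ)
    (h : ∀ i ∈ s, f i ∈ 𝒳.regOn U) : (fun x => ∏ i ∈ s, f i x) ∈ 𝒳.regOn U := by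
  have := prod_mem h
  convert this using 1
  ext x
  simp

theorem const_mem_regOn (U : Set X) (c : ℂ) : (fun _ => c) ∈ 𝒳.regOn U :=
  fun x _ => 𝒳.regAt_const c x

theorem mul_apply_mem_regOn {α β γ : Type} [Fintype β] {U : Set X} {M : X → Matrix α β ℂ}
    {M' : X → Matrix β γ ℂ} (h : ∀ i j, (fun x => M x i j) ∈ 𝒳.regOn U)
    (h' : ∀ i j, (fun x => M' x i j) ∈ 𝒳.regOn U) (i : α) (j : γ) :
    (fun x => (M x * M' x) i j) ∈ 𝒳.regOn U := by
  simp only [Matrix.mul_apply]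
  exact sum_mem_regOn _ _ _ fun k _ => mul_mem (h i k) (h' k j)

theorem pow_apply_mem_regOn {α : Type} [Fintype α] [DecidableEq α] {U : Set X}
    {M : X → Matrix α α ℂ} (h : ∀ i j, (fun x => M x i j) ∈ 𝒳.regOn U) (k : ℕ) (i j : α) :
    (fun x => (M x ^ k) i j) ∈ 𝒳.regOn U := by
  induction k generalizing i j with
  | zero => simpa using const_mem_regOn U ((1 : Matrix α α ℂ) i j)
  | succ k ih =>
    simp only [pow_succ]
    exact mul_apply_mem_regOn (fun i j => ih i j) h i j

theorem det_mem_regOn {α : Type} [Fintype α] [DecidableEq α] {U : Set X}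
    {M : X → Matrix α α ℂ} (h : ∀ i j, (fun x => M x i j) ∈ 𝒳.regOn U) :
    (fun x => (M x).det) ∈ 𝒳.regOn U := by
  simp only [Matrix.det_apply']
  exact sum_mem_regOn _ _ _ fun σ _ =>
    mul_mem (const_mem_regOn U _) (prod_mem_regOn _ _ _ fun i _ => h _ _)

/-- The entries of the inverse matrix are regular on any open set where the determinant does not
vanish. -/
theorem inv_apply_mem_regOn {α : Type} [Fintype α] [DecidableEq α] {U : Set X}
    {M : X → Matrix α α ℂ} (h : ∀ i j, (fun x => M x i j) ∈ 𝒳.regOn U)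
    (hdet : ∀ x ∈ U, (M x).det ≠ 0) (i j : α) :
    (fun x => (M x)⁻¹ i j) ∈ 𝒳.regOn U := by
  have h1 : (fun x => ((M x).det)⁻¹) ∈ 𝒳.regOn U := fun x hx =>
    𝒳.regAt_inv _ x (det_mem_regOn h x hx) (hdet x hx)
  have h2 : (fun x => (M x).adjugate i j) ∈ 𝒳.regOn U := by
    simp only [Matrix.adjugate_apply]
    refine det_mem_regOn fun k l => ?_
    by_cases hk : k = j
    · subst hk
      simpa using const_mem_regOn U _
    · simpa [Matrix.updateRow_ne hk] using h k l
  have : (fun x => (M x)⁻¹ i j) = (fun x => ((M x).det)⁻¹) * fun x => (M x).adjugate i j := by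
    ext x
    simp [Matrix.inv_def, Ring.inverse_eq_inv']
  rw [this]
  exact mul_mem h1 h2

/-! ### Affine spaces -/

theorem eval_mem_regOn {ι : Type} (P : MvPolynomial ι ℂ) :
    (fun y => MvPolynomial.eval y P) ∈ (affine ι).regOn univ :=
  fun _ _ => ⟨P, 1, by simp, fun y _ => by simp⟩

theorem coord_mem_regOn {ι : Type} (i : ι) : (fun y : ι → ℂ => y i) ∈ (affine ι).regOn univ := by
  simpa using eval_mem_regOn (MvPolynomial.X i : MvPolynomial ι ℂ)

/-- A map to an affine space with regular coordinates is a morphism. -/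
theorem isMorphism_affine {ι : Type} {φ : X → ι → ℂ}
    (h : ∀ i, (fun x => φ x i) ∈ 𝒳.regOn univ) : IsMorphism 𝒳 (affine ι) φ := by
  have hP : ∀ P : MvPolynomial ι ℂ, (fun x => MvPolynomial.eval (φ x) P) ∈ 𝒳.regOn univ := by
    intro P
    induction P using MvPolynomial.induction_on with
    | C a => simpa using const_mem_regOn univ a
    | add p q hp hq =>
      simp only [map_add]
      exact add_mem hp hq
    | mul_X p i hp =>
      simp only [map_mul, MvPolynomial.eval_X]
      exact mul_mem hp (h i)
  refine IsMorphism.of_isOpen_preimage (fun U hU => ?_) ?_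
  · refine (@isOpen_iff_forall_mem_open _ 𝒳.top _).2 fun x hx => ?_
    obtain ⟨Q, hQ, hQ'⟩ := hU (φ x) hx
    exact ⟨{y | MvPolynomial.eval (φ y) Q ≠ 0}, fun y hy => hQ' _ hy, isOpen_ne_zero (hP Q), hQ⟩
  · rintro g x ⟨P, Q, hQ, hg⟩
    refine 𝒳.regAt_congr _ _ x _ (isOpen_ne_zero (hP Q)) hQ (fun y hy => (hg _ hy).symm) ?_
    have : (fun y => MvPolynomial.eval (φ y) P / MvPolynomial.eval (φ y) Q) =
        (fun y => MvPolynomial.eval (φ y) P) * (fun y => MvPolynomial.eval (φ y) Q)⁻¹ := by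
      ext y
      simp [div_eq_mul_inv]
    rw [this]
    exact 𝒳.regAt_mul _ _ x (hP P x (mem_univ x)) (𝒳.regAt_inv _ x (hP Q x (mem_univ x)) hQ)

/-- Affine spaces with coordinates indexed by equivalent types are isomorphic. -/
def affineReindex {ι κ : Type} (e : ι ≃ κ) : Iso (affine ι) (affine κ) where
  toEquiv := e.arrowCongr (Equiv.refl ℂ)
  isMorphism := isMorphism_affine fun i => coord_mem_regOn (e.symm i)
  isMorphism_symm := isMorphism_affine fun i => coord_mem_regOn (e i)

/-- Affine space is irreducible: two nonempty Zariski open sets meet. -/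
theorem affine_inter_nonempty {ι : Type} {U V : Set (ι → ℂ)} (hU : IsOpen[(affine ι).top] U)
    (hV : IsOpen[(affine ι).top] V) (hU' : U.Nonempty) (hV' : V.Nonempty) :
    (U ∩ V).Nonempty := by
  obtain ⟨x, hx⟩ := hU'
  obtain ⟨y, hy⟩ := hV'
  obtain ⟨P, hP, hPU⟩ := hU x hx
  obtain ⟨Q, hQ, hQV⟩ := hV y hy
  have hP0 : P ≠ 0 := by rintro rfl; simp at hP
  have hQ0 : Q ≠ 0 := by rintro rfl; simp at hQ
  by_contra hne
  refine mul_ne_zero hP0 hQ0 (MvPolynomial.funext fun z => ?_)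
  by_contra hz
  rw [map_mul, map_zero] at hz
  exact hne ⟨z, hPU z (left_ne_zero_of_mul hz), hQV z (right_ne_zero_of_mul hz)⟩

/-! ### Induced and quotient structures -/

theorem isMorphism_induced (j : Y → X) : IsMorphism (𝒳.induced j) 𝒳 j :=
  IsMorphism.of_isOpen_preimage (fun U hU => ⟨U, hU, rfl⟩) fun g _ hg =>
    ⟨g, univ, @isOpen_univ _ 𝒳.top, mem_univ _, hg, fun _ _ => rfl⟩

theorem isMorphism_to_induced {j : Y → X} {φ : Z → Y} (h : IsMorphism 𝒵 𝒳 (j ∘ φ)) :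
    IsMorphism 𝒵 (𝒳.induced j) φ := by
  refine IsMorphism.of_isOpen_preimage ?_ ?_
  · rintro _ ⟨U, hU, rfl⟩
    exact h.isOpen_preimage hU
  · rintro g z ⟨g', U, hU, hzU, hg', hgg'⟩
    exact 𝒵.regAt_congr _ _ z _ (h.isOpen_preimage hU) hzU (fun y hy => (hgg' _ hy).symm)
      (h.2 g' z hg')

theorem isMorphism_subtype_val (S : Set X) : IsMorphism (𝒳.sub S) 𝒳 Subtype.val :=
  isMorphism_induced _

theorem isMorphism_coinduced (q : X → Y) : IsMorphism 𝒳 (𝒳.coinduced q) q :=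
  IsMorphism.of_isOpen_preimage (fun _ hU => hU) fun _ x ⟨_, _, hxV, h⟩ => h x hxV

/-- On a set `T` with open preimage, a function is regular for the quotient structure as soon as
its pullback is regular. -/
theorem mem_regOn_coinduced {q : X → Y} {T : Set Y} (hT : IsOpen[𝒳.top] (q ⁻¹' T))
    {f : Y → ℂ} (hf : f ∘ q ∈ 𝒳.regOn (q ⁻¹' T)) : f ∈ (𝒳.coinduced q).regOn T :=
  fun _ hy => ⟨T, hT, hy, fun x hx => hf x hx⟩

theorem restrict_mem_regOn {S T : Set X} (hST : S ⊆ T) {f : X → ℂ} (hf : f ∈ 𝒳.regOn T) :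
    (fun x : S => f x) ∈ (𝒳.sub S).regOn univ :=
  fun x _ => (isMorphism_subtype_val S).2 f x (hf _ (hST x.2))

/-- The Zariski closure of a set contains every limit of a family that is parametrised by an affine
space and lies generically in the set. -/
theorem mem_closure_induced {ι κ : Type} {j : X → ι → ℂ} {Γ : (κ → ℂ) → ι → ℂ}
    (hΓ : IsMorphism (affine κ) (affine ι) Γ) {G : Set (κ → ℂ)} (hG : IsOpen[(affine κ).top] G)
    (hG' : G.Nonempty) {D : Set X} (h : ∀ w ∈ G, ∃ x ∈ D, j x = Γ w) {x : X} {w : κ → ℂ}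
    (hw : Γ w = j x) : x ∈ ((affine ι).induced j).closure D := by
  refine (@mem_closure_iff _ ((affine ι).induced j).top _ _).2 ?_
  rintro _ ⟨U, hU, rfl⟩ hx
  obtain ⟨v, hvU, hvG⟩ := affine_inter_nonempty (hΓ.isOpen_preimage hU) hG
    ⟨w, by rw [mem_preimage, hw]; exact hx⟩ hG'
  obtain ⟨y, hyD, hy⟩ := h v hvG
  exact ⟨y, by rw [mem_preimage, hy]; exact hvU, hyD⟩

theorem IsMorphism.map_mem_closure {φ : X → Y} (hφ : IsMorphism 𝒳 𝒴 φ) {S : Set X} {T : Set Y}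
    (hST : MapsTo φ S T) {x : X} (hx : x ∈ 𝒳.closure S) : φ x ∈ 𝒴.closure T :=
  @_root_.map_mem_closure _ _ 𝒳.top 𝒴.top _ _ _ _ hφ.1 hx hST

/-! ### Products -/

theorem isMorphism_fst : IsMorphism (𝒳.prod 𝒴) 𝒳 Prod.fst := by
  refine IsMorphism.of_isOpen_preimage (fun U hU z hz => ?_) fun g z hg => ?_
  · exact ⟨U, univ, hU, @isOpen_univ _ 𝒴.top, ⟨hz, mem_univ _⟩, 1, one_mem _, by simp,
      fun w hw _ => hw.1⟩
  · obtain ⟨U, hU, hzU, h⟩ := 𝒳.regAt_nhds g _ hg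
    exact ⟨U, univ, hU, @isOpen_univ _ 𝒴.top, ⟨hzU, mem_univ _⟩, fun w => g w.1,
      Algebra.subset_adjoin (Or.inl ⟨g, h, rfl⟩), 1, one_mem _, by simp, fun w _ _ => by simp⟩

theorem isMorphism_snd : IsMorphism (𝒳.prod 𝒴) 𝒴 Prod.snd := by
  refine IsMorphism.of_isOpen_preimage (fun U hU z hz => ?_) fun g z hg => ?_
  · exact ⟨univ, U, @isOpen_univ _ 𝒳.top, hU, ⟨mem_univ _, hz⟩, 1, one_mem _, by simp,
      fun w hw _ => hw.2⟩
  · obtain ⟨U, hU, hzU, h⟩ := 𝒴.regAt_nhds g _ hg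
    exact ⟨univ, U, @isOpen_univ _ 𝒳.top, hU, ⟨mem_univ _, hzU⟩, fun w => g w.2,
      Algebra.subset_adjoin (Or.inr ⟨g, h, rfl⟩), 1, one_mem _, by simp, fun w _ _ => by simp⟩

theorem comp_mem_regOn_of_mem_tensorOn {φ : Z → X × Y} (h1 : IsMorphism 𝒵 𝒳 fun z => (φ z).1)
    (h2 : IsMorphism 𝒵 𝒴 fun z => (φ z).2) {U : Set X} {V : Set Y} {Q : X × Y → ℂ}
    (hQ : Q ∈ 𝒳.tensorOn 𝒴 U V) : Q ∘ φ ∈ 𝒵.regOn (φ ⁻¹' U ×ˢ V) := by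
  induction hQ using Algebra.adjoin_induction with
  | mem F hF =>
    rcases hF with ⟨f, hf, rfl⟩ | ⟨g, hg, rfl⟩
    · exact fun z hz => h1.2 f z (hf _ hz.1)
    · exact fun z hz => h2.2 g z (hg _ hz.2)
  | algebraMap c => exact (𝒵.regOn _).algebraMap_mem c
  | add F G _ _ hF hG => exact add_mem hF hG
  | mul F G _ _ hF hG => exact mul_mem hF hG

/-- The universal property of the product. -/
theorem isMorphism_prod {φ : Z → X × Y} (h1 : IsMorphism 𝒵 𝒳 fun z => (φ z).1)
    (h2 : IsMorphism 𝒵 𝒴 fun z => (φ z).2) : IsMorphism 𝒵 (𝒳.prod 𝒴) φ := by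
  have hbasic : ∀ {U : Set X} {V : Set Y} {Q : X × Y → ℂ}, IsOpen[𝒳.top] U → IsOpen[𝒴.top] V →
      Q ∈ 𝒳.tensorOn 𝒴 U V → IsOpen[𝒵.top] {z | φ z ∈ U ×ˢ V ∧ Q (φ z) ≠ 0} := by
    intro U V Q hU hV hQ
    refine (@isOpen_iff_forall_mem_open _ 𝒵.top _).2 fun z hz => ?_
    obtain ⟨T, hT, hzT, h⟩ := 𝒵.regAt_ne_zero _ z
      (comp_mem_regOn_of_mem_tensorOn h1 h2 hQ z hz.1) hz.2
    refine ⟨T ∩ ((fun z => (φ z).1) ⁻¹' U ∩ (fun z => (φ z).2) ⁻¹' V), ?_, ?_, ?_⟩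
    · exact fun y hy => ⟨hy.2, h y hy.1⟩
    · exact @IsOpen.inter _ 𝒵.top _ _ hT
        (@IsOpen.inter _ 𝒵.top _ _ (h1.isOpen_preimage hU) (h2.isOpen_preimage hV))
    · exact ⟨hzT, hz.1⟩
  refine IsMorphism.of_isOpen_preimage (fun W hW => ?_) ?_
  · refine (@isOpen_iff_forall_mem_open _ 𝒵.top _).2 fun z hz => ?_
    obtain ⟨U, V, hU, hV, hzUV, Q, hQ, hQz, h⟩ := hW _ hz
    exact ⟨_, fun y hy => h _ hy.1 hy.2, hbasic hU hV hQ, hzUV, hQz⟩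
  · rintro F z ⟨U, V, hU, hV, hzUV, P, hP, Q, hQ, hQz, h⟩
    refine 𝒵.regAt_congr ((P ∘ φ) * (Q ∘ φ)⁻¹) _ z _ (hbasic hU hV hQ) ⟨hzUV, hQz⟩
      (fun y hy => ?_) ?_
    · simp [h _ hy.1 hy.2, div_eq_mul_inv]
    · exact 𝒵.regAt_mul _ _ z (comp_mem_regOn_of_mem_tensorOn h1 h2 hP z hzUV)
        (𝒵.regAt_inv _ z (comp_mem_regOn_of_mem_tensorOn h1 h2 hQ z hzUV) hQz)

/-- The projection from a product is an open map. -/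
theorem isOpen_image_fst {W : Set (X × Y)} (hW : IsOpen[(𝒳.prod 𝒴).top] W) :
    IsOpen[𝒳.top] (Prod.fst '' W) := by
  refine (@isOpen_iff_forall_mem_open _ 𝒳.top _).2 ?_
  rintro _ ⟨⟨x, y⟩, hxy, rfl⟩
  have h : IsMorphism 𝒳 (𝒳.prod 𝒴) fun x => (x, y) :=
    isMorphism_prod isMorphism_id (isMorphism_const y)
  exact ⟨_, fun x' hx' => ⟨(x', y), hx', rfl⟩, h.isOpen_preimage hW, hxy⟩

/-- Replacing the first factor of a product by an isomorphic one. -/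
def Iso.prodLeft (e : Iso 𝒳 𝒵) (𝒴 : SpaceWithFunctions Y) : Iso (𝒳.prod 𝒴) (𝒵.prod 𝒴) where
  toEquiv := e.toEquiv.prodCongr (Equiv.refl Y)
  isMorphism := isMorphism_prod (e.isMorphism.comp isMorphism_fst) isMorphism_snd
  isMorphism_symm := isMorphism_prod (e.isMorphism_symm.comp isMorphism_fst) isMorphism_snd

/-- The product of two affine spaces is an affine space. -/
def affineProd (ι κ : Type) : Iso ((affine ι).prod (affine κ)) (affine (ι ⊕ κ)) where
  toEquiv := (Equiv.sumArrowEquivProdArrow ι κ ℂ).symm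
  isMorphism := isMorphism_affine fun i => by
    rcases i with i | i
    · exact isMorphism_fst.comp_mem_regOn (coord_mem_regOn i)
    · exact isMorphism_snd.comp_mem_regOn (coord_mem_regOn i)
  isMorphism_symm := isMorphism_prod
    (isMorphism_affine fun i => coord_mem_regOn (Sum.inl i))
    (isMorphism_affine fun i => coord_mem_regOn (Sum.inr i))

end SpaceWithFunctions

/-! ### Spans of vectors and coordinate subspaces -/

/-- The number of indices `s` with `f s < k`. -/
def countBelow {n : ℕ} (f : Fin n → ℕ) (k : ℕ) : ℕ :=
  (Finset.univ.filter fun s => f s < k).card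

/-- If `V` lies in the coordinate subspace of the indices in `P`, and contains the columns of index
in `P` of an invertible matrix, then the dimension of `V` is the number of these indices. -/
theorem finrank_eq_card_of_coordinate {n : ℕ} {V : Submodule ℂ (Fin n → ℂ)}
    {g : Matrix (Fin n) (Fin n) ℂ} (hg : g.det ≠ 0) (P : Fin n → Prop) [DecidablePred P]
    (h1 : ∀ v ∈ V, ∀ s, ¬ P s → v s = 0) (h2 : ∀ s, P s → g.col s ∈ V) :
    Module.finrank ℂ V = (Finset.univ.filter P).card := by
  apply le_antisymm
  · have hV : V ≤ Submodule.span ℂ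
        (range fun s : {s // P s} => Pi.single (M := fun _ => ℂ) s.1 1) := by
      intro v hv
      rw [pi_eq_sum_univ' v]
      refine Submodule.sum_mem _ fun s _ => ?_
      by_cases hs : P s
      · refine Submodule.smul_mem _ _ (Submodule.subset_span ⟨⟨s, hs⟩, ?_⟩)
        ext t
        simp [Pi.single_apply]
      · rw [h1 v hv s hs, zero_smul]
        exact zero_mem _
    calc Module.finrank ℂ V ≤ _ := Submodule.finrank_mono hV
      _ ≤ Fintype.card {s // P s} := finrank_range_le_card _
      _ = _ := Fintype.card_subtype P
  · have hli : LinearIndependent ℂ fun s : {s // P s} => g.col s.1 :=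
      (Matrix.linearIndependent_cols_of_det_ne_zero hg).comp _ Subtype.val_injective
    rw [← Fintype.card_subtype P, ← finrank_span_eq_card hli]
    refine Submodule.finrank_mono (Submodule.span_le.2 ?_)
    rintro _ ⟨s, rfl⟩
    exact h2 s.1 s.2

/-- In the coordinates given by the columns of `g`, the span of some of the columns is a coordinate
subspace. -/
theorem inv_mulVec_apply_eq_zero {n : ℕ} {g : Matrix (Fin n) (Fin n) ℂ} (hg : g.det ≠ 0)
    {P : Fin n → Prop} {v : Fin n → ℂ} (hv : v ∈ Submodule.span ℂ (g.col '' {s | P s}))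
    {s : Fin n} (hs : ¬ P s) : g⁻¹.mulVec v s = 0 := by
  induction hv using Submodule.span_induction with
  | mem v hv =>
    obtain ⟨t, ht, rfl⟩ := hv
    have hst : s ≠ t := by rintro rfl; exact hs ht
    have : g⁻¹.mulVec (g.col t) s = (g⁻¹ * g) s t := rfl
    rw [this, Matrix.nonsing_inv_mul _ (isUnit_iff_ne_zero.2 hg), Matrix.one_apply_ne hst]
  | zero => simp
  | add v w _ _ hv hw => rw [Matrix.mulVec_add, Pi.add_apply, hv, hw, add_zero]
  | smul c v _ hv => rw [Matrix.mulVec_smul, Pi.smul_apply, hv, smul_zero]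

/-- A filtration `V` whose steps are spanned by vectors `g s` of level `f s` is, at each stage,
spanned by the vectors of lower level. -/
theorem filtration_le_span {n : ℕ} {E : Type} [AddCommGroup E] [Module ℂ E]
    {V : ℕ → Submodule ℂ E} {g : Fin n → E} {f : Fin n → ℕ} (h0 : V 0 = ⊥) {b : ℕ}
    (hstep : ∀ k < b, V (k + 1) ≤ V k ⊔ Submodule.span ℂ (g '' {s | f s = k})) {k : ℕ}
    (hk : k ≤ b) : V k ≤ Submodule.span ℂ (g '' {s | f s < k}) := by
  induction k with
  | zero => simp [h0]
  | succ k ih =>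
    refine (hstep k hk).trans (sup_le ((ih (by omega)).trans ?_) ?_)
    · exact Submodule.span_mono (image_mono fun s (hs : f s < k) => Nat.lt_succ_of_lt hs)
    · exact Submodule.span_mono (image_mono fun s (hs : f s = k) => by
        rw [mem_ofPred_eq, hs]; exact Nat.lt_succ_self k)

theorem det_ne_zero_of_span_eq_top {n : ℕ} {g : Matrix (Fin n) (Fin n) ℂ}
    (h : ⊤ ≤ Submodule.span ℂ (range g.col)) : g.det ≠ 0 := by
  have hli : LinearIndependent ℂ g.col :=
    linearIndependent_of_top_le_span_of_card_eq_finrank h (by simp)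
  exact ((Matrix.isUnit_iff_isUnit_det g).1
    (Matrix.linearIndependent_cols_iff_isUnit.1 hli)).ne_zero

/-- Consider the chain of subspaces `W + span {u₀, …, uₒ₋₁}` of `W'`. If it has reached `W'`
whenever one of its steps is an equality, then it reaches `W'` after at most
`dim W' - dim W` steps. -/
theorem sup_span_eq_of_finrank {n : ℕ} {W W' : Submodule ℂ (Fin n → ℂ)} {u : ℕ → Fin n → ℂ}
    (hW : W ≤ W') (hu : ∀ o, u o ∈ W')
    (hconst : ∀ o, u o ∈ W ⊔ Submodule.span ℂ (u '' {i | i < o}) →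
      W' ≤ W ⊔ Submodule.span ℂ (u '' {i | i < o}))
    {k : ℕ} (hk : Module.finrank ℂ W' ≤ Module.finrank ℂ W + k) :
    W' ≤ W ⊔ Submodule.span ℂ (u '' {i | i < k}) := by
  set F : ℕ → Submodule ℂ (Fin n → ℂ) := fun o => W ⊔ Submodule.span ℂ (u '' {i | i < o})
  have hmono : ∀ o, F o ≤ F (o + 1) := fun o => sup_le_sup_left
    (Submodule.span_mono (image_mono fun i (hi : i < o) => Nat.lt_succ_of_lt hi)) _
  have hle : ∀ o, F o ≤ W' := fun o => sup_le hW (Submodule.span_le.2 (by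
    rintro _ ⟨i, _, rfl⟩; exact hu i))
  have key : ∀ o, W' ≤ F o ∨ Module.finrank ℂ W + o ≤ Module.finrank ℂ (F o) := by
    intro o
    induction o with
    | zero => exact Or.inr (Submodule.finrank_mono le_sup_left)
    | succ o ih =>
      rcases ih with ih | ih
      · exact Or.inl (ih.trans (hmono o))
      · by_cases ho : u o ∈ F o
        · exact Or.inl ((hconst o ho).trans (hmono o))
        · have hlt : F o < F (o + 1) := lt_of_le_of_ne (hmono o) fun heq => ho (by
            rw [heq]
            exact Submodule.mem_sup_right (Submodule.subset_span ⟨o, Nat.lt_succ_self o, rfl⟩))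
          have := Submodule.finrank_lt_finrank_of_lt hlt
          right; omega
  rcases key k with h | h
  · exact h
  · exact (Submodule.eq_of_le_of_finrank_le (hle k) (hk.trans h)).ge

/-! ### Semicontinuity of the dimension -/

namespace SpaceWithFunctions

/-- The dimension of the span of a family of vectors that depend regularly on a parameter is lower
semicontinuous. Independence of finitely many of the vectors is witnessed by a constant left inverse
`T` of the matrix they form at the given point: `det (T * v)` does not vanish nearby. -/
theorem isOpen_le_finrank_span {X κ : Type} {𝒳 : SpaceWithFunctions X} {n : ℕ}
    {u : X → κ → Fin n → ℂ} (hu : ∀ i r, (fun x => u x i r) ∈ 𝒳.regOn univ) (d : ℕ) :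
    IsOpen[𝒳.top] {x | d ≤ Module.finrank ℂ (Submodule.span ℂ (range (u x)))} := by
  refine (@isOpen_iff_forall_mem_open _ 𝒳.top _).2 fun x hx => ?_
  obtain ⟨t, hli⟩ : ∃ t : Fin d → κ, LinearIndependent ℂ fun i => u x (t i) := by
    obtain ⟨ι, a, -, hspan, hli⟩ := exists_linearIndependent' ℂ (u x)
    have := hli.finite
    have := Fintype.ofFinite ι
    rw [mem_ofPred_eq, ← hspan, finrank_span_eq_card hli, ← Fintype.card_fin d] at hx
    obtain ⟨c⟩ := Function.Embedding.nonempty_of_card_le hx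
    exact ⟨fun i => a (c i), hli.comp c c.injective⟩
  set v : X → Matrix (Fin n) (Fin d) ℂ := fun y => Matrix.of fun r i => u y (t i) r with hv
  have hinj : Function.Injective (v x).mulVec :=
    Matrix.mulVec_injective_iff.2 hli
  obtain ⟨T, hT⟩ : ∃ T : Matrix (Fin d) (Fin n) ℂ, T * v x = 1 := by
    obtain ⟨T, hT⟩ := LinearMap.exists_leftInverse_of_injective (Matrix.toLin' (v x))
      (LinearMap.ker_eq_bot.2 hinj)
    refine ⟨LinearMap.toMatrix' T, ?_⟩
    rw [← LinearMap.toMatrix'_toLin' (v x), ← LinearMap.toMatrix'_comp, hT,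
      LinearMap.toMatrix'_id]
  refine ⟨{y | (T * v y).det ≠ 0}, fun y hy => ?_, isOpen_ne_zero ?_, ?_⟩
  · have hinj' : Function.Injective (v y).mulVec := by
      intro a b hab
      have h1 : (T * v y).mulVec a = (T * v y).mulVec b := by
        rw [← Matrix.mulVec_mulVec, ← Matrix.mulVec_mulVec, hab]
      exact Matrix.mulVec_injective_of_isUnit
        ((Matrix.isUnit_iff_isUnit_det _).2 (isUnit_iff_ne_zero.2 hy)) h1
    have hli' : LinearIndependent ℂ fun i => u y (t i) := Matrix.mulVec_injective_iff.1 hinj'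
    have h2 := finrank_span_eq_card hli'
    rw [Fintype.card_fin] at h2
    rw [mem_ofPred_eq, ← h2]
    exact Submodule.finrank_mono (Submodule.span_mono (by rintro _ ⟨i, rfl⟩; exact ⟨t i, rfl⟩))
  · exact det_mem_regOn fun i j => mul_apply_mem_regOn (M := fun _ => T)
      (fun i j => const_mem_regOn _ _) (fun i j => hu _ _) i j
  · simp [hT]

end SpaceWithFunctions

/-! ### Strata of a semicontinuous rank function -/

/-- The points at which the ranks `ρ x k`, `k ≤ b`, have prescribed values. -/
def rankStratum {X : Type} (ρ : X → ℕ → ℕ) (b : ℕ) (r : ℕ → ℕ) : Set X :=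
  {x | ∀ k ≤ b, ρ x k = r k}

theorem isLocallyClosed_rankStratum {X : Type} [TopologicalSpace X] {ρ : X → ℕ → ℕ} {b : ℕ}
    (hρ : ∀ k d, IsOpen {x | d ≤ ρ x k}) (r : ℕ → ℕ) :
    IsLocallyClosed (rankStratum ρ b r) := by
  refine ⟨⋂ k ∈ {k | k ≤ b}, {x | r k ≤ ρ x k}, ⋂ k ∈ {k | k ≤ b}, {x | r k + 1 ≤ ρ x k}ᶜ,
    (finite_le_nat b).isOpen_biInter fun k _ => hρ k _,
    isClosed_biInter fun k _ => (hρ k _).isClosed_compl, ?_⟩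
  ext x
  simp only [rankStratum, mem_ofPred_eq, mem_inter_iff, mem_iInter, mem_compl_iff, ← forall_and]
  exact forall_congr' fun k => forall_congr' fun _ => by omega

theorem le_of_mem_closure_rankStratum {X : Type} [TopologicalSpace X] {ρ : X → ℕ → ℕ} {b : ℕ}
    (hρ : ∀ k d, IsOpen {x | d ≤ ρ x k}) {r : ℕ → ℕ} {x : X}
    (hx : x ∈ closure (rankStratum ρ b r)) {k : ℕ} (hk : k ≤ b) : ρ x k ≤ r k := by
  by_contra h
  obtain ⟨y, hy, hy'⟩ := mem_closure_iff.1 hx _ (hρ k (r k + 1)) (by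
    rw [mem_ofPred_eq]; omega)
  rw [mem_ofPred_eq, hy' k hk] at hy
  omega

/-! ### Multi-indices -/

theorem lt_countBelow {n : ℕ} {f : Fin n → ℕ} (hf : Monotone f) {s : Fin n} {k : ℕ} :
    (s : ℕ) < countBelow f k ↔ f s < k := by
  constructor
  · intro h
    by_contra hk
    have hsub : (Finset.univ.filter fun t => f t < k) ⊆ Finset.Iio s := fun t ht => by
      rw [Finset.mem_filter] at ht
      rw [Finset.mem_Iio]
      by_contra hst
      exact hk ((hf (not_lt.1 hst)).trans_lt ht.2)
    have := Finset.card_le_card hsub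
    rw [Fin.card_Iio] at this
    exact absurd h (not_lt.2 this)
  · intro h
    have hsub : Finset.Iic s ⊆ Finset.univ.filter fun t => f t < k := fun t ht => by
      rw [Finset.mem_filter]
      exact ⟨Finset.mem_univ _, (hf (Finset.mem_Iic.1 ht)).trans_lt h⟩
    have := Finset.card_le_card hsub
    rw [Fin.card_Iic] at this
    exact this

theorem countBelow_le {n : ℕ} (f : Fin n → ℕ) (k : ℕ) : countBelow f k ≤ n :=
  (Finset.card_filter_le _ _).trans (by simp)

theorem countBelow_mono {n : ℕ} (f : Fin n → ℕ) : Monotone (countBelow f) :=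
  fun _ _ hkl => Finset.card_le_card fun s hs => by
    rw [Finset.mem_filter] at hs ⊢
    exact ⟨hs.1, hs.2.trans_le hkl⟩

theorem countBelow_eq {n : ℕ} {f : Fin n → ℕ} {k : ℕ} (h : ∀ s, f s < k) : countBelow f k = n := by
  simp [countBelow, h]

theorem le_of_countBelow_le {n b : ℕ} {f f' : Fin n → ℕ} (hf : Monotone f) (hf' : Monotone f')
    (hb : ∀ s, f s ≤ b) (h : ∀ k ≤ b, countBelow f' k ≤ countBelow f k) (s : Fin n) :
    f s ≤ f' s := by
  by_contra hs
  have h1 : (s : ℕ) < countBelow f' (f s) := (lt_countBelow hf').2 (not_le.1 hs)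
  exact lt_irrefl _ ((lt_countBelow hf).1 (h1.trans_le (h _ (hb s))))

/-- A sequence of ranks that increases from `0` to `n` in `b` steps counts the elements below the
values of a monotone function. -/
theorem exists_countBelow_eq {n b : ℕ} {ρ : ℕ → ℕ} (h0 : ρ 0 = 0) (hρ : Monotone ρ)
    (hb : ρ b = n) :
    ∃ f : Fin n → ℕ, Monotone f ∧ (∀ s, f s < b) ∧ ∀ k ≤ b, countBelow f k = ρ k := by
  classical
  have hex : ∀ s : Fin n, ∃ k, (s : ℕ) < ρ (k + 1) := fun s =>
    ⟨b, lt_of_lt_of_le (hb.symm ▸ s.2 : (s : ℕ) < ρ b) (hρ (Nat.le_succ b))⟩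
  have hlt : ∀ s k, Nat.find (hex s) < k ↔ (s : ℕ) < ρ k := by
    intro s k
    rw [Nat.find_lt_iff]
    constructor
    · rintro ⟨l, hl, h⟩
      exact h.trans_le (hρ hl)
    · intro h
      rcases k with _ | k
      · rw [h0] at h; omega
      · exact ⟨k, Nat.lt_succ_self k, h⟩
  refine ⟨fun s => Nat.find (hex s), fun s t hst => ?_, fun s => ?_, fun k hk => ?_⟩
  · exact Nat.find_min' _ (lt_of_le_of_lt (Fin.le_def.1 hst) (Nat.find_spec (hex t)))
  · exact (hlt s b).2 (hb.symm ▸ s.2)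
  · have hkn : ρ k ≤ n := hb ▸ hρ hk
    simp only [countBelow, hlt]
    have : (Finset.univ.filter fun s : Fin n => (s : ℕ) < ρ k).card =
        (Finset.range (ρ k)).card := by
      refine Finset.card_bij (fun s _ => (s : ℕ)) (fun s hs => ?_) (fun s _ t _ => Fin.ext)
        fun l hl => ?_
      · simpa using hs
      · rw [Finset.mem_range] at hl
        exact ⟨⟨l, hl.trans_le hkn⟩, by simpa using hl, rfl⟩
    rw [this, Finset.card_range]

namespace MultiIndex

variable {n N : ℕ}

/-- The elements of a multi-index in increasing order. -/
def elt (I : MultiIndex n N) : Fin n ↪o Fin N := I.1.orderEmbOfFin I.2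

/-- The `s`-th element of a multi-index as a natural number, so between `0` and `N - 1`. -/
def pos (I : MultiIndex n N) (s : Fin n) : ℕ := I.elt s

/-- The number of elements of the complement of a multi-index below its `s`-th element. -/
def block (I : MultiIndex n N) (s : Fin n) : ℕ := I.pos s - s

theorem pos_strictMono (I : MultiIndex n N) : StrictMono I.pos :=
  fun _ _ h => I.elt.strictMono h

theorem elt_mem (I : MultiIndex n N) (s : Fin n) : I.elt s ∈ I.1 :=
  Finset.orderEmbOfFin_mem _ _ s

theorem exists_elt_eq (I : MultiIndex n N) {q : Fin N} (hq : q ∈ I.1) : ∃ s, I.elt s = q := by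
  have := Finset.range_orderEmbOfFin I.1 I.2
  rw [← Finset.mem_coe, ← this] at hq
  exact hq

theorem pos_add_le (I : MultiIndex n N) {s t : Fin n} (hst : s ≤ t) :
    I.pos s + t ≤ I.pos t + s := by
  obtain ⟨d, hd⟩ := Nat.exists_eq_add_of_le (Fin.le_def.1 hst)
  induction d generalizing t with
  | zero =>
    have : t = s := Fin.ext (by omega)
    rw [this]
  | succ d ih =>
    have h1 : (s : ℕ) + d < n := by have := t.2; omega
    have h2 := ih (t := ⟨s + d, h1⟩) (Fin.le_def.2 (by simp)) rfl
    have h3 : I.pos ⟨s + d, h1⟩ < I.pos t := I.pos_strictMono (Fin.lt_def.2 (by simp; omega))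
    simp only at h2
    omega

theorem le_pos (I : MultiIndex n N) (s : Fin n) : (s : ℕ) ≤ I.pos s := by
  have h := I.pos_add_le (s := ⟨0, by have := s.2; omega⟩) (t := s) (Fin.le_def.2 (by simp))
  simp only at h
  omega

theorem pos_add_lt (I : MultiIndex n N) (s : Fin n) : I.pos s + n ≤ N + s := by
  have h := I.pos_add_le (s := s) (t := ⟨n - 1, by have := s.2; omega⟩)
    (Fin.le_def.2 (by have := s.2; simp; omega))
  have h2 : I.pos ⟨n - 1, by have := s.2; omega⟩ < N := (I.elt _).2
  have := s.2
  simp only at h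
  omega

theorem block_add (I : MultiIndex n N) (s : Fin n) : I.block s + s = I.pos s :=
  Nat.sub_add_cancel (I.le_pos s)

theorem block_mono (I : MultiIndex n N) : Monotone I.block := fun s t hst => by
  have := I.pos_add_le hst
  have := I.block_add s
  have := I.block_add t
  omega

theorem block_lt {m n : ℕ} (I : MultiIndex n (m + n - 1)) (s : Fin n) : I.block s < m := by
  have := I.pos_add_lt s
  have := I.block_add s
  have := s.2
  omega

theorem card_filter_lt (I : MultiIndex n N) (k : ℕ) :
    (I.1.filter fun j : Fin N => (j : ℕ) < k).card = countBelow I.pos k := by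
  symm
  refine Finset.card_bij (fun s _ => I.elt s) (fun s hs => ?_) (fun s _ t _ h => I.elt.injective h)
    fun q hq => ?_
  · rw [Finset.mem_filter] at hs ⊢
    exact ⟨I.elt_mem s, hs.2⟩
  · rw [Finset.mem_filter] at hq
    obtain ⟨s, rfl⟩ := I.exists_elt_eq hq.1
    exact ⟨s, Finset.mem_filter.2 ⟨Finset.mem_univ _, hq.2⟩, rfl⟩

theorem eq_of_pos_eq {I J : MultiIndex n N} (h : ∀ s, I.pos s = J.pos s) : I = J := by
  refine Subtype.ext (Finset.ext fun q => ⟨fun hq => ?_, fun hq => ?_⟩)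
  · obtain ⟨s, rfl⟩ := I.exists_elt_eq hq
    rw [Fin.ext (h s) (a := I.elt s) (b := J.elt s)]
    exact J.elt_mem s
  · obtain ⟨s, rfl⟩ := J.exists_elt_eq hq
    rw [← Fin.ext (h s) (a := I.elt s) (b := J.elt s)]
    exact I.elt_mem s

/-- Multi-indices in `{0, …, N - 1}` are strictly increasing sequences. -/
theorem exists_pos_eq {f : Fin n → ℕ} (hf : StrictMono f) (hN : ∀ s, f s < N) :
    ∃ I : MultiIndex n N, ∀ s, I.pos s = f s := by
  let g : Fin n → Fin N := fun s => ⟨f s, hN s⟩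
  have hg : StrictMono g := fun s t h => hf h
  let I : MultiIndex n N := ⟨Finset.univ.image g, by
    rw [Finset.card_image_of_injective _ hg.injective, Finset.card_univ, Fintype.card_fin]⟩
  refine ⟨I, fun s => ?_⟩
  have := Finset.orderEmbOfFin_unique I.2 (f := g) (fun t => by simp [I]) hg
  exact congrArg Fin.val (congrFun this s).symm

theorem exists_block_eq {m n : ℕ} {f : Fin n → ℕ} (hf : Monotone f) (hm : ∀ s, f s < m) :
    ∃ I : MultiIndex n (m + n - 1), ∀ s, I.block s = f s := by
  obtain ⟨I, hI⟩ := exists_pos_eq (N := m + n - 1) (f := fun s => f s + s)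
    (fun s t h => by
      have := hf h.le
      have := Fin.lt_def.1 h
      simp only; omega)
    (fun s => by have := hm s; have := s.2; omega)
  exact ⟨I, fun s => by rw [block, hI]; omega⟩

theorem block_le_block_iff {I J : MultiIndex n N} (s : Fin n) :
    I.block s ≤ J.block s ↔ I.pos s ≤ J.pos s := by
  have := I.block_add s
  have := J.block_add s
  omega

theorem card_filter_notMem (I : MultiIndex n N) (s : Fin n) :
    (I.1ᶜ.filter fun c => I.elt s < c).card + I.pos s + n = N + s := by
  have h1 : (Finset.Ioi (I.elt s)).card = N - 1 - I.pos s := Fin.card_Ioi _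
  have h2 : (I.1.filter fun c => I.elt s < c).card = n - 1 - s := by
    rw [← Fin.card_Ioi s]
    symm
    refine Finset.card_bij (fun t _ => I.elt t) (fun t ht => ?_)
      (fun t _ t' _ h => I.elt.injective h) fun q hq => ?_
    · rw [Finset.mem_filter]
      exact ⟨I.elt_mem t, I.elt.strictMono (Finset.mem_Ioi.1 ht)⟩
    · rw [Finset.mem_filter] at hq
      obtain ⟨t, rfl⟩ := I.exists_elt_eq hq.1
      exact ⟨t, Finset.mem_Ioi.2 (I.elt.lt_iff_lt.1 hq.2), rfl⟩
  have h3 : (I.1.filter fun c => I.elt s < c).card + (I.1ᶜ.filter fun c => I.elt s < c).card =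
      (Finset.Ioi (I.elt s)).card := by
    rw [← Finset.card_union_of_disjoint
      (Finset.disjoint_filter_filter disjoint_compl_right), ← Finset.filter_union,
      Finset.union_compl]
    congr 1
    ext c
    simp
  have h4 : I.pos s < N := (I.elt s).2
  have := I.pos_add_lt s
  have := s.2
  omega

theorem schubertDim_eq_sum (I : MultiIndex n N) :
    schubertDim I = ∑ s, (I.1ᶜ.filter fun c => I.elt s < c).card := by
  have h : ∀ c, (I.1.filter fun i => i < c).card =
      (Finset.univ.filter fun s => I.elt s < c).card := fun c => by
    symm
    refine Finset.card_bij (fun s _ => I.elt s) (fun s hs => ?_)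
      (fun s _ t _ h => I.elt.injective h) fun q hq => ?_
    · rw [Finset.mem_filter] at hs ⊢
      exact ⟨I.elt_mem s, hs.2⟩
    · rw [Finset.mem_filter] at hq
      obtain ⟨s, rfl⟩ := I.exists_elt_eq hq.1
      exact ⟨s, by simpa using hq.2, rfl⟩
  simp only [schubertDim, h, Finset.card_filter]
  exact Finset.sum_comm

theorem schubertDim_add_sum (I : MultiIndex n N) :
    schubertDim I + ∑ s, I.pos s + n * n = n * N + ∑ s : Fin n, (s : ℕ) := by
  have := Finset.sum_congr (rfl : (Finset.univ : Finset (Fin n)) = _)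
    fun s _ => I.card_filter_notMem s
  simpa [Finset.sum_add_distrib, schubertDim_eq_sum] using this

theorem schubertDim_lt {I J : MultiIndex n N} (hne : I ≠ J) (h : ∀ s, J.pos s ≤ I.pos s) :
    schubertDim I < schubertDim J := by
  have h1 : ∑ s, J.pos s < ∑ s, I.pos s := by
    refine Finset.sum_lt_sum (fun s _ => h s) ?_
    by_contra hcon
    push Not at hcon
    exact hne (eq_of_pos_eq fun s => le_antisymm (hcon s (Finset.mem_univ s)) (h s))
  have := I.schubertDim_add_sum
  have := J.schubertDim_add_sum
  omega

end MultiIndex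

namespace SpaceWithFunctions

section Strata

variable {X J : Type} {𝒳 : SpaceWithFunctions X} {n b : ℕ} {ρ : X → ℕ → ℕ} {f : J → Fin n → ℕ}

/-- The closure relations between the strata of a semicontinuous rank function, once every stratum
is known to lie in the closure of the larger ones. -/
theorem rankStratum_subset_closure_iff (hf : ∀ j, Monotone (f j)) (hb : ∀ j s, f j s ≤ b)
    (hρ : ∀ k d, IsOpen[𝒳.top] {x | d ≤ ρ x k})
    (hne : ∀ j, (rankStratum ρ b (countBelow (f j))).Nonempty)
    (hcl : ∀ i j, (∀ s, f j s ≤ f i s) → rankStratum ρ b (countBelow (f i)) ⊆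
      𝒳.closure (rankStratum ρ b (countBelow (f j)))) (i j : J) :
    rankStratum ρ b (countBelow (f i)) ⊆ 𝒳.closure (rankStratum ρ b (countBelow (f j))) ↔
      ∀ s, f j s ≤ f i s := by
  refine ⟨fun h => ?_, hcl i j⟩
  obtain ⟨x, hx⟩ := hne i
  refine le_of_countBelow_le (hf j) (hf i) (hb j) fun k hk => ?_
  rw [← hx k hk]
  let _ := 𝒳.top
  exact le_of_mem_closure_rankStratum hρ (h hx) hk

/-- The strata of a semicontinuous rank function form a cell decomposition as soon as they are
affine spaces, and every stratum lies in the closure of the larger ones. -/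
theorem isCellDecomposition_rankStratum [Finite J] {d : J → ℕ} (hf : ∀ j, Monotone (f j))
    (hb : ∀ j s, f j s ≤ b) (hρ : ∀ k d, IsOpen[𝒳.top] {x | d ≤ ρ x k})
    (hcover : ∀ x, ∃ j, x ∈ rankStratum ρ b (countBelow (f j)))
    (hcl : ∀ i j, (∀ s, f j s ≤ f i s) → rankStratum ρ b (countBelow (f i)) ⊆
      𝒳.closure (rankStratum ρ b (countBelow (f j))))
    (hd : ∀ i j, i ≠ j → (∀ s, f j s ≤ f i s) → d i < d j)
    (hcell : ∀ j, Nonempty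
      (Iso (𝒳.sub (rankStratum ρ b (countBelow (f j)))) (affine (Fin (d j))))) :
    𝒳.IsCellDecomposition (fun j => rankStratum ρ b (countBelow (f j))) d where
  disjoint i j hij := by
    rw [Set.disjoint_left]
    intro x hi hj
    have h1 : ∀ s, f i s ≤ f j s := le_of_countBelow_le (hf i) (hf j) (hb i) fun k hk =>
      ((hj k hk).symm.trans (hi k hk)).le
    have h2 : ∀ s, f j s ≤ f i s := le_of_countBelow_le (hf j) (hf i) (hb j) fun k hk =>
      ((hi k hk).symm.trans (hj k hk)).le
    exact lt_asymm (hd i j hij h2) (hd j i hij.symm h1)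
  cover := eq_univ_of_forall fun x => mem_iUnion.2 (hcover x)
  locallyClosed j := by
    let _ := 𝒳.top
    exact isLocallyClosed_rankStratum hρ _
  cell := hcell
  closure_union i j := by
    rintro ⟨x, hx, hx'⟩
    refine hcl i j (le_of_countBelow_le (hf j) (hf i) (hb j) fun k hk => ?_)
    rw [← hx k hk]
    let _ := 𝒳.top
    exact le_of_mem_closure_rankStratum hρ hx' hk
  dim_lt i j hij h := by
    obtain ⟨⟨e⟩⟩ := hcell i
    refine hd i j hij ((rankStratum_subset_closure_iff hf hb hρ (fun j => ?_) hcl i j).1 h)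
    obtain ⟨e⟩ := hcell j
    exact ⟨_, (e.toEquiv.symm 0).2⟩

end Strata

end SpaceWithFunctions

open SpaceWithFunctions

/-! ### Schubert cells -/

section Schubert

variable {n N : ℕ}

/-- The variety of matrices of full rank. -/
def fullRankStr (n N : ℕ) : SpaceWithFunctions (FullRankMatrix n N) :=
  (affine (Fin n × Fin N)).induced fun M ij => M.1 ij.1 ij.2

theorem fullRank_entry_mem_regOn (i : Fin n) (j : Fin N) :
    (fun M : FullRankMatrix n N => M.1 i j) ∈ (fullRankStr n N).regOn univ :=
  (isMorphism_induced _).comp_mem_regOn (coord_mem_regOn (i, j))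

theorem isMorphism_rowSpace : IsMorphism (fullRankStr n N) (gras n N) rowSpace :=
  isMorphism_coinduced _

theorem rowSpace_surjective : Function.Surjective (rowSpace : FullRankMatrix n N → Gras n N) := by
  rintro ⟨W, hW⟩
  let b := Module.finBasisOfFinrankEq ℂ W hW
  refine ⟨⟨Matrix.of fun i => (b i : Fin N → ℂ),
    b.linearIndependent.map' W.subtype W.ker_subtype⟩, Subtype.ext ?_⟩
  have : (range fun i => (b i : Fin N → ℂ)) = W.subtype '' range b := by
    rw [← range_comp]
    rfl
  change Submodule.span ℂ (range fun i => (b i : Fin N → ℂ)) = W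
  rw [this, Submodule.span_image, b.span_eq, Submodule.map_top, Submodule.range_subtype]

/-- The dimension of the projection of a subspace to the first `k` coordinates. -/
def grasRank (W : Gras n N) (k : ℕ) : ℕ :=
  Module.finrank ℂ (W.1.map (LinearMap.funLeft ℂ ℂ
    (Subtype.val : {j : Fin N // (j : ℕ) < k} → Fin N)))

theorem schubertCell_eq_rankStratum (I : MultiIndex n N) :
    schubertCell I = rankStratum grasRank N (countBelow I.pos) := by
  ext W
  simp only [schubertCell, rankStratum, mem_ofPred_eq, I.card_filter_lt, grasRank]

theorem grasRank_rowSpace (M : FullRankMatrix n N) (k : ℕ) :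
    grasRank (rowSpace M) k = Module.finrank ℂ (Submodule.span ℂ
      (range fun q : {q : Fin N // (q : ℕ) < k} => M.1.col q)) := by
  set A : Matrix (Fin n) {q : Fin N // (q : ℕ) < k} ℂ := M.1.submatrix id Subtype.val
  have h1 : (rowSpace M).1.map (LinearMap.funLeft ℂ ℂ
      (Subtype.val : {j : Fin N // (j : ℕ) < k} → Fin N)) =
      Submodule.span ℂ (range A.row) := by
    change (Submodule.span ℂ (range fun i => M.1 i)).map _ = _
    rw [Submodule.map_span, ← range_comp]
    rfl
  have h2 : (fun q : {q : Fin N // (q : ℕ) < k} => M.1.col q) = A.col := rfl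
  rw [grasRank, h1, h2, ← Matrix.rank_eq_finrank_span_row, Matrix.rank_eq_finrank_span_cols]

theorem isOpen_le_grasRank (k d : ℕ) : IsOpen[(gras n N).top] {W | d ≤ grasRank W k} := by
  change IsOpen[(fullRankStr n N).top] (rowSpace ⁻¹' {W | d ≤ grasRank W k})
  have h : rowSpace ⁻¹' {W | d ≤ grasRank W k} = {M : FullRankMatrix n N | d ≤ Module.finrank ℂ
      (Submodule.span ℂ (range fun q : {q : Fin N // (q : ℕ) < k} => M.1.col q))} := by
    ext M
    rw [mem_preimage, mem_ofPred_eq, mem_ofPred_eq, grasRank_rowSpace]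
  rw [h]
  exact isOpen_le_finrank_span (u := fun (M : FullRankMatrix n N)
    (q : {q : Fin N // (q : ℕ) < k}) => M.1.col q)
    (fun q r => fullRank_entry_mem_regOn r q.1) d

theorem exists_mul_of_rowSpace_eq {M M' : FullRankMatrix n N} (h : rowSpace M = rowSpace M') :
    ∃ g : Matrix (Fin n) (Fin n) ℂ, g.det ≠ 0 ∧ M'.1 = g * M.1 := by
  have key : ∀ {M M' : FullRankMatrix n N}, rowSpace M = rowSpace M' →
      ∃ g : Matrix (Fin n) (Fin n) ℂ, M'.1 = g * M.1 := by
    intro M M' h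
    have hmem : ∀ i, M'.1 i ∈ Submodule.span ℂ (range fun i => M.1 i) := fun i => by
      have : M'.1 i ∈ (rowSpace M').1 := Submodule.subset_span ⟨i, rfl⟩
      rwa [← h] at this
    choose g hg using fun i => (Submodule.mem_span_range_iff_exists_fun ℂ).1 (hmem i)
    refine ⟨Matrix.of g, Matrix.ext fun i j => ?_⟩
    rw [← hg i, Matrix.mul_apply]
    simp
  obtain ⟨g, hg⟩ := key h
  obtain ⟨g', hg'⟩ := key h.symm
  refine ⟨g, ?_, hg⟩
  have hinj : Function.Injective M.1.vecMul :=
    Matrix.vecMul_injective_iff.2 M.2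
  have : g' * g = 1 := by
    refine funext fun i => hinj ?_
    have h1 : g' * g * M.1 = (1 : Matrix (Fin n) (Fin n) ℂ) * M.1 := by
      rw [Matrix.mul_assoc, ← hg, ← hg', Matrix.one_mul]
    have h2 := congrFun h1 i
    rwa [Matrix.mul_apply_eq_vecMul, Matrix.mul_apply_eq_vecMul] at h2
  exact Matrix.det_ne_zero_of_left_inverse this

/-- The square matrix of the columns with indices in `I`. -/
def pivotMatrix (I : MultiIndex n N) (M : Matrix (Fin n) (Fin N) ℂ) : Matrix (Fin n) (Fin n) ℂ :=
  M.submatrix id I.elt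

theorem pivotMatrix_mul (I : MultiIndex n N) (g : Matrix (Fin n) (Fin n) ℂ)
    (M : Matrix (Fin n) (Fin N) ℂ) : pivotMatrix I (g * M) = g * pivotMatrix I M := rfl

/-- The representative, among the matrices with the same row space, whose columns with indices in
`I` are the unit vectors. If the columns with indices in `I` are dependent, it has no meaning. -/
def reduced (I : MultiIndex n N) (M : Matrix (Fin n) (Fin N) ℂ) : Matrix (Fin n) (Fin N) ℂ :=
  (pivotMatrix I M)⁻¹ * M

theorem reduced_mul (I : MultiIndex n N) {g : Matrix (Fin n) (Fin n) ℂ} (hg : g.det ≠ 0)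
    (M : Matrix (Fin n) (Fin N) ℂ) : reduced I (g * M) = reduced I M := by
  rw [reduced, pivotMatrix_mul, Matrix.mul_inv_rev, Matrix.mul_assoc, ← Matrix.mul_assoc g⁻¹,
    Matrix.nonsing_inv_mul _ (isUnit_iff_ne_zero.2 hg), Matrix.one_mul, reduced]

theorem linearIndependent_of_pivotMatrix {I : MultiIndex n N} {M : Matrix (Fin n) (Fin N) ℂ}
    (h : (pivotMatrix I M).det ≠ 0) : LinearIndependent ℂ fun i => M i :=
  LinearIndependent.of_comp (LinearMap.funLeft ℂ ℂ I.elt)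
    (Matrix.linearIndependent_rows_of_det_ne_zero h)

theorem rowSpace_mul (M : FullRankMatrix n N) {g : Matrix (Fin n) (Fin n) ℂ}
    {M' : FullRankMatrix n N} (h : M'.1 = g * M.1) : rowSpace M' = rowSpace M := by
  refine Subtype.ext (Submodule.eq_of_le_of_finrank_eq (Submodule.span_le.2 ?_)
    ((rowSpace M').2.trans (rowSpace M).2.symm))
  rintro _ ⟨i, rfl⟩
  simp only [h, Matrix.mul_apply_eq_vecMul]
  rw [SetLike.mem_coe, rowSpace]
  exact (Submodule.mem_span_range_iff_exists_fun ℂ).2 ⟨g i, by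
    rw [Matrix.vecMul_eq_sum]⟩

/-- A matrix with vanishing entries to the left of the positions of `I`, and invertible
`I`-columns, has its row space in the Schubert cell of `I`. -/
theorem rowSpace_mem_schubertCell {I : MultiIndex n N} {M : FullRankMatrix n N}
    (h : (pivotMatrix I M.1).det ≠ 0) (h0 : ∀ s (q : Fin N), (q : ℕ) < I.pos s → M.1 s q = 0) :
    rowSpace M ∈ schubertCell I := by
  rw [schubertCell_eq_rankStratum]
  intro k _
  rw [grasRank_rowSpace]
  refine finrank_eq_card_of_coordinate h _ (fun v hv s hs => ?_) fun s hs =>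
    Submodule.subset_span ⟨⟨I.elt s, hs⟩, rfl⟩
  induction hv using Submodule.span_induction with
  | mem v hv =>
    obtain ⟨q, rfl⟩ := hv
    exact h0 s q (q.2.trans_le (not_lt.1 hs))
  | zero => rfl
  | add v w _ _ hv hw => rw [Pi.add_apply, hv, hw, add_zero]
  | smul c v _ hv => rw [Pi.smul_apply, hv, smul_zero]

/-- In the Schubert cell of `I`, the columns with indices in `I` span the column spaces of the
truncated matrices. -/
theorem span_col_le {I : MultiIndex n N} {M : FullRankMatrix n N}
    (h : rowSpace M ∈ schubertCell I) {k : ℕ} (hk : k ≤ N) :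
    Submodule.span ℂ (range fun q : {q : Fin N // (q : ℕ) < k} => M.1.col q) ≤
      Submodule.span ℂ ((pivotMatrix I M.1).col '' {s | I.pos s < k}) := by
  rw [schubertCell_eq_rankStratum] at h
  refine filtration_le_span (V := fun k => Submodule.span ℂ
    (range fun q : {q : Fin N // (q : ℕ) < k} => M.1.col q)) (by simp) (fun k hk => ?_) hk
  by_cases hkI : (⟨k, hk⟩ : Fin N) ∈ I.1
  · obtain ⟨s, hs⟩ := I.exists_elt_eq hkI
    refine Submodule.span_le.2 ?_
    rintro _ ⟨⟨q, hq⟩, rfl⟩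
    rcases Nat.lt_succ_iff_lt_or_eq.1 hq with hq | hq
    · exact Submodule.mem_sup_left (Submodule.subset_span ⟨⟨q, hq⟩, rfl⟩)
    · refine Submodule.mem_sup_right (Submodule.subset_span ⟨s, ?_, ?_⟩)
      · exact congrArg Fin.val hs
      · have : q = I.elt s := by rw [hs]; exact Fin.ext hq
        simp only [this]
        rfl
  · refine le_trans (Submodule.eq_of_le_of_finrank_eq (Submodule.span_mono ?_) ?_).ge le_sup_left
    · rintro _ ⟨⟨q, hq⟩, rfl⟩
      exact ⟨⟨q, Nat.lt_succ_of_lt hq⟩, rfl⟩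
    · rw [← grasRank_rowSpace, ← grasRank_rowSpace, h k hk.le, h (k + 1) hk]
      refine congrArg Finset.card (Finset.filter_congr fun s _ => ?_)
      have : I.pos s ≠ k := fun hs => hkI (by
        have := I.elt_mem s
        rwa [show I.elt s = ⟨k, hk⟩ from Fin.ext hs] at this)
      omega

theorem det_pivotMatrix_ne_zero {I : MultiIndex n N} {M : FullRankMatrix n N}
    (h : rowSpace M ∈ schubertCell I) : (pivotMatrix I M.1).det ≠ 0 := by
  have h1 := span_col_le h le_rfl
  rw [schubertCell_eq_rankStratum] at h
  have h2 := h N le_rfl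
  rw [grasRank_rowSpace, countBelow_eq (f := I.pos) fun s => (I.elt s).2] at h2
  have h3 := Submodule.eq_top_of_finrank_eq (h2.trans (Module.finrank_fin_fun ℂ).symm)
  rw [h3] at h1
  exact det_ne_zero_of_span_eq_top (h1.trans (Submodule.span_mono (image_subset_range _ _)))

theorem reduced_pivot (I : MultiIndex n N) {M : Matrix (Fin n) (Fin N) ℂ}
    (h : (pivotMatrix I M).det ≠ 0) : pivotMatrix I (reduced I M) = 1 := by
  rw [reduced, pivotMatrix_mul, Matrix.nonsing_inv_mul _ (isUnit_iff_ne_zero.2 h)]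

theorem reduced_eq_zero {I : MultiIndex n N} {M : FullRankMatrix n N}
    (h : rowSpace M ∈ schubertCell I) {s : Fin n} {q : Fin N} (hq : (q : ℕ) < I.pos s) :
    reduced I M.1 s q = 0 := by
  have h1 : M.1.col q ∈ Submodule.span ℂ ((pivotMatrix I M.1).col '' {s | I.pos s < q + 1}) :=
    span_col_le h q.2 (Submodule.subset_span ⟨⟨q, Nat.lt_succ_self _⟩, rfl⟩)
  exact inv_mulVec_apply_eq_zero (det_pivotMatrix_ne_zero h) h1 (by omega)

/-! ### Reduced echelon matrices -/

/-- The positions of the free entries of a reduced echelon matrix with pivots in `I`. -/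
abbrev SchubertCoord (I : MultiIndex n N) : Type :=
  {z : Fin n × Fin N // I.elt z.1 < z.2 ∧ z.2 ∉ I.1}

theorem card_schubertCoord (I : MultiIndex n N) :
    Fintype.card (SchubertCoord I) = schubertDim I := by
  rw [I.schubertDim_eq_sum, Fintype.card_subtype, Finset.card_filter, Fintype.sum_prod_type]
  refine Finset.sum_congr rfl fun s _ => ?_
  rw [← Finset.card_filter]
  congr 1
  ext q
  simp [and_comm]

/-- The reduced echelon matrix with pivots in `I` and given free entries. -/
def echelon (I : MultiIndex n N) (x : SchubertCoord I → ℂ) : Matrix (Fin n) (Fin N) ℂ :=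
  Matrix.of fun s q =>
    if h : I.elt s < q ∧ q ∉ I.1 then x ⟨(s, q), h⟩ else if I.elt s = q then 1 else 0

theorem pivotMatrix_echelon (I : MultiIndex n N) (x : SchubertCoord I → ℂ) :
    pivotMatrix I (echelon I x) = 1 := by
  ext s t
  have h : ¬ (I.elt s < I.elt t ∧ I.elt t ∉ I.1) := fun h => h.2 (I.elt_mem t)
  change (if h : I.elt s < I.elt t ∧ I.elt t ∉ I.1 then x ⟨(s, I.elt t), h⟩ else
    if I.elt s = I.elt t then 1 else 0) = _
  rw [dif_neg h]
  simp [Matrix.one_apply]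

theorem det_pivotMatrix_echelon (I : MultiIndex n N) (x : SchubertCoord I → ℂ) :
    (pivotMatrix I (echelon I x)).det ≠ 0 := by
  rw [pivotMatrix_echelon, Matrix.det_one]
  exact one_ne_zero

theorem reduced_echelon (I : MultiIndex n N) (x : SchubertCoord I → ℂ) :
    reduced I (echelon I x) = echelon I x := by
  rw [reduced, pivotMatrix_echelon, inv_one, Matrix.one_mul]

theorem echelon_eq_zero (I : MultiIndex n N) (x : SchubertCoord I → ℂ) {s : Fin n} {q : Fin N}
    (hq : (q : ℕ) < I.pos s) : echelon I x s q = 0 := by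
  have hq' : q < I.elt s := hq
  have h : ¬ (I.elt s < q ∧ q ∉ I.1) := fun h => lt_asymm h.1 hq'
  simp [echelon, dif_neg h, hq'.ne']

/-- The reduced echelon matrix as a matrix of full rank. -/
def echelonFull (I : MultiIndex n N) (x : SchubertCoord I → ℂ) : FullRankMatrix n N :=
  ⟨echelon I x, linearIndependent_of_pivotMatrix (det_pivotMatrix_echelon I x)⟩

theorem rowSpace_echelonFull_mem (I : MultiIndex n N) (x : SchubertCoord I → ℂ) :
    rowSpace (echelonFull I x) ∈ schubertCell I :=
  rowSpace_mem_schubertCell (det_pivotMatrix_echelon I x) fun _ _ => echelon_eq_zero I x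

theorem reduced_eq_echelon {I : MultiIndex n N} {M : FullRankMatrix n N}
    (h : rowSpace M ∈ schubertCell I) :
    reduced I M.1 = echelon I fun z => reduced I M.1 z.1.1 z.1.2 := by
  have h1 := reduced_pivot I (det_pivotMatrix_ne_zero h)
  ext s q
  by_cases hq : q ∈ I.1
  · obtain ⟨t, rfl⟩ := I.exists_elt_eq hq
    have h2 := congrFun (congrFun (h1.trans (pivotMatrix_echelon I
      fun z => reduced I M.1 z.1.1 z.1.2).symm) s) t
    exact h2
  · rcases lt_trichotomy (I.elt s) q with hs | hs | hs
    · simp [echelon, hs, hq]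
    · exact absurd (hs ▸ I.elt_mem s) hq
    · rw [reduced_eq_zero h hs, echelon_eq_zero I _ hs]

/-- A matrix of full rank with a given row space. -/
def rowSpaceRep (W : Gras n N) : FullRankMatrix n N :=
  Function.surjInv rowSpace_surjective W

theorem rowSpace_rowSpaceRep (W : Gras n N) : rowSpace (rowSpaceRep W) = W :=
  Function.surjInv_eq rowSpace_surjective W

theorem reduced_rowSpaceRep (I : MultiIndex n N) (M : FullRankMatrix n N) :
    reduced I (rowSpaceRep (rowSpace M)).1 = reduced I M.1 := by
  obtain ⟨g, hg, h⟩ := exists_mul_of_rowSpace_eq (rowSpace_rowSpaceRep (rowSpace M)).symm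
  rw [h, reduced_mul I hg]

theorem det_pivotMatrix_rowSpaceRep (I : MultiIndex n N) (M : FullRankMatrix n N) :
    (pivotMatrix I (rowSpaceRep (rowSpace M)).1).det ≠ 0 ↔ (pivotMatrix I M.1).det ≠ 0 := by
  obtain ⟨g, hg, h⟩ := exists_mul_of_rowSpace_eq (rowSpace_rowSpaceRep (rowSpace M)).symm
  rw [h, pivotMatrix_mul, Matrix.det_mul, mul_ne_zero_iff]
  exact and_iff_right hg

theorem reduced_mem_regOn (I : MultiIndex n N) (s : Fin n) (q : Fin N) :
    (fun W : Gras n N => reduced I (rowSpaceRep W).1 s q) ∈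
      (gras n N).regOn {W | (pivotMatrix I (rowSpaceRep W).1).det ≠ 0} := by
  have hpre : rowSpace ⁻¹' {W : Gras n N | (pivotMatrix I (rowSpaceRep W).1).det ≠ 0} =
      {M | (pivotMatrix I M.1).det ≠ 0} := by
    ext M
    exact det_pivotMatrix_rowSpaceRep I M
  have hfun : (fun W : Gras n N => reduced I (rowSpaceRep W).1 s q) ∘ rowSpace =
      fun M => reduced I M.1 s q := by
    ext M
    simp only [Function.comp, reduced_rowSpaceRep]
  have hent : ∀ (U : Set (FullRankMatrix n N)) i j,
      (fun M : FullRankMatrix n N => M.1 i j) ∈ (fullRankStr n N).regOn U :=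
    fun U i j M _ => fullRank_entry_mem_regOn i j M (mem_univ M)
  refine mem_regOn_coinduced (𝒳 := fullRankStr n N) ?_ ?_
  · rw [hpre]
    exact isOpen_ne_zero (det_mem_regOn fun i j => hent _ i (I.elt j))
  · rw [hpre, hfun]
    exact mul_apply_mem_regOn (M := fun M : FullRankMatrix n N => (pivotMatrix I M.1)⁻¹)
      (M' := fun M => M.1)
      (inv_apply_mem_regOn (fun i j => hent _ i (I.elt j)) fun _ h => h) (hent _) s q

theorem isMorphism_echelonFull (I : MultiIndex n N) :
    IsMorphism (affine (SchubertCoord I)) (fullRankStr n N) (echelonFull I) := by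
  refine isMorphism_to_induced (isMorphism_affine ?_)
  rintro ⟨s, q⟩
  by_cases h : I.elt s < q ∧ q ∉ I.1
  · simpa [echelonFull, echelon, h] using coord_mem_regOn (⟨(s, q), h⟩ : SchubertCoord I)
  · simpa [echelonFull, echelon, dif_neg h] using const_mem_regOn _ _

/-- A Schubert cell is an affine space: its coordinates are the free entries of the reduced echelon
matrix. -/
def schubertCellIso (I : MultiIndex n N) :
    Iso ((gras n N).sub (schubertCell I)) (affine (SchubertCoord I)) where
  toEquiv :=
    { toFun := fun W z => reduced I (rowSpaceRep W.1).1 z.1.1 z.1.2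
      invFun := fun x => ⟨rowSpace (echelonFull I x), rowSpace_echelonFull_mem I x⟩
      left_inv := by
        rintro ⟨W, hW⟩
        obtain ⟨M, rfl⟩ := rowSpace_surjective W
        refine Subtype.ext (rowSpace_mul M (g := (pivotMatrix I M.1)⁻¹) ?_)
        simp only [reduced_rowSpaceRep]
        exact (reduced_eq_echelon hW).symm
      right_inv := by
        intro x
        ext ⟨⟨s, q⟩, h⟩
        simp only [reduced_rowSpaceRep, echelonFull, reduced_echelon]
        simp [echelon, h] }
  isMorphism := isMorphism_affine fun z => restrict_mem_regOn
    (fun W hW => by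
      refine det_pivotMatrix_ne_zero (M := rowSpaceRep W) ?_
      rwa [rowSpace_rowSpaceRep]) (reduced_mem_regOn I z.1.1 z.1.2)
  isMorphism_symm := isMorphism_to_induced (isMorphism_rowSpace.comp (isMorphism_echelonFull I))

theorem nonempty_schubertCell_iso (I : MultiIndex n N) :
    Nonempty (Iso ((gras n N).sub (schubertCell I)) (affine (Fin (schubertDim I)))) :=
  ⟨(schubertCellIso I).trans
    (affineReindex (Fintype.equivFinOfCardEq (card_schubertCoord I)))⟩

/-- Every subspace in the smaller cell is a limit of subspaces in the larger cell: all matrices with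
zeros to the left of the positions of `I` form a vector space, which contains the reduced echelon
matrices of the smaller cell, and in which the row space generically lies in the cell of `I`. -/
theorem schubertCell_subset_closure {I J : MultiIndex n N} (h : ∀ s, I.pos s ≤ J.pos s) :
    schubertCell J ⊆ (gras n N).closure (schubertCell I) := by
  intro W hW
  obtain ⟨M, rfl⟩ := rowSpace_surjective W
  have hrow : rowSpace M = rowSpace (echelonFull J fun z => reduced J M.1 z.1.1 z.1.2) :=
    (rowSpace_mul M (g := (pivotMatrix J M.1)⁻¹) (reduced_eq_echelon hW).symm).symm
  rw [hrow]
  set M' := echelonFull J fun z => reduced J M.1 z.1.1 z.1.2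
  refine isMorphism_rowSpace.map_mem_closure (S := rowSpace ⁻¹' schubertCell I)
    (fun _ hM => hM) ?_
  let mask : (Fin n × Fin N → ℂ) → Matrix (Fin n) (Fin N) ℂ := fun w =>
    Matrix.of fun s q => if (q : ℕ) < I.pos s then 0 else w (s, q)
  have hmask : ∀ s q, (fun w => mask w s q) ∈ (affine (Fin n × Fin N)).regOn univ := by
    intro s q
    by_cases hq : (q : ℕ) < I.pos s
    · simpa [mask, hq] using const_mem_regOn _ _
    · simpa [mask, hq] using coord_mem_regOn (s, q)
  have hfix : ∀ M : Matrix (Fin n) (Fin N) ℂ, (∀ s (q : Fin N), (q : ℕ) < I.pos s → M s q = 0) →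
      mask (fun z => M z.1 z.2) = M := by
    intro M hM
    ext s q
    by_cases hq : (q : ℕ) < I.pos s
    · simp [mask, hq, hM s q hq]
    · simp [mask, hq]
  refine mem_closure_induced (Γ := fun w z => mask w z.1 z.2)
    (isMorphism_affine fun z => hmask z.1 z.2)
    (G := {w | (pivotMatrix I (mask w)).det ≠ 0})
    (isOpen_ne_zero (det_mem_regOn fun i j => hmask i (I.elt j))) ?_ (fun w hw => ?_)
    (w := fun z => M'.1 z.1 z.2) ?_
  · refine ⟨fun z => echelon I 0 z.1 z.2, ?_⟩
    rw [mem_ofPred_eq, hfix _ fun s q hq => echelon_eq_zero I 0 hq]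
    exact det_pivotMatrix_echelon I 0
  · refine ⟨⟨mask w, linearIndependent_of_pivotMatrix hw⟩, ?_, rfl⟩
    refine rowSpace_mem_schubertCell hw fun s q hq => ?_
    simp [mask, hq]
  · have := hfix M'.1 fun s q hq =>
      echelon_eq_zero J (fun z => reduced J M.1 z.1.1 z.1.2) (hq.trans_le (h s))
    exact funext fun z => congrFun (congrFun this z.1) z.2

theorem exists_mem_schubertCell (W : Gras n N) : ∃ I, W ∈ schubertCell (N := N) (n := n) I := by
  classical
  obtain ⟨M, rfl⟩ := rowSpace_surjective W
  set V : ℕ → Submodule ℂ (Fin n → ℂ) := fun k =>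
    Submodule.span ℂ (range fun q : {q : Fin N // (q : ℕ) < k} => M.1.col q) with hV
  have hmono : Monotone V := fun k l hkl => Submodule.span_mono (by
    rintro _ ⟨⟨q, hq⟩, rfl⟩
    exact ⟨⟨q, hq.trans_le hkl⟩, rfl⟩)
  have hstep : ∀ k, Module.finrank ℂ (V (k + 1)) ≤ Module.finrank ℂ (V k) + 1 := by
    intro k
    by_cases hk : k < N
    · have h1 : V (k + 1) ≤ V k ⊔ Submodule.span ℂ {M.1.col ⟨k, hk⟩} := by
        refine Submodule.span_le.2 ?_
        rintro _ ⟨⟨q, hq⟩, rfl⟩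
        rcases Nat.lt_succ_iff_lt_or_eq.1 hq with hq | hq
        · exact Submodule.mem_sup_left (Submodule.subset_span ⟨⟨q, hq⟩, rfl⟩)
        · have : q = ⟨k, hk⟩ := Fin.ext hq
          simp only [this]
          exact Submodule.mem_sup_right (Submodule.subset_span rfl)
      refine (Submodule.finrank_mono h1).trans
        ((Submodule.finrank_add_le_finrank_add_finrank _ _).trans ?_)
      exact Nat.add_le_add_left ((finrank_span_le_card _).trans (by simp)) _
    · have h1 : V (k + 1) ≤ V k := Submodule.span_mono (by
        rintro _ ⟨⟨q, hq⟩, rfl⟩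
        exact ⟨⟨q, by have := q.2; omega⟩, rfl⟩)
      exact (Submodule.finrank_mono h1).trans (Nat.le_succ _)
  have hN : Module.finrank ℂ (V N) = n := by
    have h1 : Module.finrank ℂ (V N) = grasRank (rowSpace M) N := (grasRank_rowSpace M N).symm
    have hinj : Function.Injective (LinearMap.funLeft ℂ ℂ
        (Subtype.val : {j : Fin N // (j : ℕ) < N} → Fin N)) :=
      LinearMap.funLeft_injective_of_surjective _ _ _ fun j => ⟨⟨j, j.2⟩, rfl⟩
    rw [h1, grasRank, ← (Submodule.equivMapOfInjective _ hinj _).finrank_eq, (rowSpace M).2]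
  obtain ⟨f, hf, hfN, hcount⟩ := exists_countBelow_eq (n := n) (b := N)
    (ρ := fun k => Module.finrank ℂ (V k)) (by simp [hV])
    (fun k l hkl => Submodule.finrank_mono (hmono hkl)) hN
  have hstrict : StrictMono f := by
    intro s t hst
    refine lt_of_le_of_ne (hf hst.le) fun heq => ?_
    have h1 : ¬ (s : ℕ) < countBelow f (f s) := fun h => lt_irrefl _ ((lt_countBelow hf).1 h)
    have h2 : (t : ℕ) < countBelow f (f s + 1) := (lt_countBelow hf).2 (by omega)
    rw [hcount _ (hfN s).le] at h1
    rw [hcount (f s + 1) (hfN s)] at h2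
    have := hstep (f s)
    have := Fin.lt_def.1 hst
    omega
  obtain ⟨I, hI⟩ := MultiIndex.exists_pos_eq hstrict hfN
  refine ⟨I, ?_⟩
  rw [schubertCell_eq_rankStratum]
  intro k hk
  rw [grasRank_rowSpace, show I.pos = f from funext hI, hcount k hk]

end Schubert

namespace LinearSystem

variable {m n p : ℕ}

/-! ### Reachable subspaces -/

theorem ext_of_eq {S S' : LinearSystem m n p} (hA : S.A = S'.A) (hB : S.B = S'.B)
    (hC : S.C = S'.C) : S = S' := by
  cases S; cases S'; simp_all

/-- The vector `Aᵒ bⱼ`, where `bⱼ` is the `j`-th column of `B`. -/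
def reach (S : LinearSystem m n p) (o : ℕ) (j : Fin m) : Fin n → ℂ :=
  (S.A ^ o * S.B).col j

/-- The subspace that is reachable from the inputs of index `< k`: the `A`-invariant subspace
generated by the first `k` columns of `B`. -/
def reachSpan (S : LinearSystem m n p) (k : ℕ) : Submodule ℂ (Fin n → ℂ) :=
  Submodule.span ℂ (range fun z : ℕ × {j : Fin m // (j : ℕ) < k} => S.reach z.1 z.2)

/-- The dimensions of the reachable subspaces. -/
def reachRank (S : LinearSystem m n p) (k : ℕ) : ℕ :=
  Module.finrank ℂ (S.reachSpan k)

theorem reach_mem (S : LinearSystem m n p) {k : ℕ} (o : ℕ) {j : Fin m} (hj : (j : ℕ) < k) :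
    S.reach o j ∈ S.reachSpan k :=
  Submodule.subset_span ⟨(o, ⟨j, hj⟩), rfl⟩

theorem reachSpan_le {S : LinearSystem m n p} {k : ℕ} {V : Submodule ℂ (Fin n → ℂ)}
    (h : ∀ o (j : Fin m), (j : ℕ) < k → S.reach o j ∈ V) : S.reachSpan k ≤ V :=
  Submodule.span_le.2 (by rintro _ ⟨⟨o, j, hj⟩, rfl⟩; exact h o j hj)

theorem reachSpan_mono (S : LinearSystem m n p) : Monotone S.reachSpan := fun _ _ hkl =>
  reachSpan_le fun o _ hj => S.reach_mem o (hj.trans_le hkl)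

theorem reachSpan_zero (S : LinearSystem m n p) : S.reachSpan 0 = ⊥ :=
  le_bot_iff.1 (reachSpan_le fun _ _ hj => absurd hj (Nat.not_lt_zero _))

theorem mulVec_reach (S : LinearSystem m n p) (o : ℕ) (j : Fin m) :
    S.A.mulVec (S.reach o j) = S.reach (o + 1) j := by
  have : S.A.mulVec (S.reach o j) = (S.A * (S.A ^ o * S.B)).col j := rfl
  rw [this, ← Matrix.mul_assoc, ← pow_succ', reach]

theorem mulVec_mem_reachSpan (S : LinearSystem m n p) {k : ℕ} {v : Fin n → ℂ}
    (hv : v ∈ S.reachSpan k) : S.A.mulVec v ∈ S.reachSpan k := by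
  have : S.reachSpan k ≤ (S.reachSpan k).comap S.A.mulVecLin :=
    reachSpan_le fun o j hj => by
      rw [Submodule.mem_comap, Matrix.mulVecLin_apply, mulVec_reach]
      exact S.reach_mem _ hj
  exact this hv

theorem reachRank_eq_of_isCompletelyControllable {S : LinearSystem m n p}
    (h : S.IsCompletelyControllable) : S.reachRank m = n := by
  refine le_antisymm ((Submodule.finrank_le _).trans (by simp)) ?_
  rw [IsCompletelyControllable, Matrix.rank_eq_finrank_span_cols] at h
  conv_lhs => rw [← h]
  refine Submodule.finrank_mono (Submodule.span_le.2 ?_)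
  rintro _ ⟨⟨o, j⟩, rfl⟩
  exact S.reach_mem o j.2

/-! ### Base change -/

/-- Base change in the state space by an invertible matrix `g`. -/
def conj (g : Matrix (Fin n) (Fin n) ℂ) (S : LinearSystem m n p) : LinearSystem m n p :=
  ⟨g * S.A * g⁻¹, g * S.B, S.C * g⁻¹⟩

theorem equivalent_iff {S S' : LinearSystem m n p} :
    S.Equivalent S' ↔ ∃ g : Matrix (Fin n) (Fin n) ℂ, g.det ≠ 0 ∧ S' = S.conj g := by
  constructor
  · rintro ⟨g, hA, hB, hC⟩
    refine ⟨g, ((Matrix.isUnit_iff_isUnit_det _).1 g.isUnit).ne_zero, ext_of_eq ?_ hB ?_⟩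
    · rw [hA, Matrix.coe_units_inv]; rfl
    · rw [hC, Matrix.coe_units_inv]; rfl
  · rintro ⟨g, hg, rfl⟩
    refine ⟨Matrix.GeneralLinearGroup.mkOfDetNeZero g hg, ?_, rfl, ?_⟩
    · rw [Matrix.coe_units_inv]; rfl
    · rw [Matrix.coe_units_inv]; rfl

theorem conj_conj (g h : Matrix (Fin n) (Fin n) ℂ) (S : LinearSystem m n p) :
    (S.conj g).conj h = S.conj (h * g) := by
  simp only [conj, Matrix.mul_inv_rev, Matrix.mul_assoc]

theorem reach_conj {g : Matrix (Fin n) (Fin n) ℂ} (hg : g.det ≠ 0) (S : LinearSystem m n p)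
    (o : ℕ) (j : Fin m) : (S.conj g).reach o j = g.mulVec (S.reach o j) := by
  induction o with
  | zero =>
    have : g.mulVec (S.reach 0 j) = (g * (S.A ^ 0 * S.B)).col j := rfl
    rw [this, reach, conj, pow_zero, pow_zero, Matrix.one_mul, Matrix.one_mul]
  | succ o ih =>
    rw [← mulVec_reach, ih, ← mulVec_reach, conj, Matrix.mulVec_mulVec, Matrix.mulVec_mulVec,
      Matrix.mul_assoc, Matrix.nonsing_inv_mul _ (isUnit_iff_ne_zero.2 hg), Matrix.mul_one]

theorem reachSpan_conj {g : Matrix (Fin n) (Fin n) ℂ} (hg : g.det ≠ 0) (S : LinearSystem m n p)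
    (k : ℕ) : (S.conj g).reachSpan k = (S.reachSpan k).map g.mulVecLin := by
  rw [reachSpan, reachSpan, Submodule.map_span, ← range_comp]
  congr 2
  ext1 z
  exact reach_conj hg S _ _

theorem reachRank_conj {g : Matrix (Fin n) (Fin n) ℂ} (hg : g.det ≠ 0) (S : LinearSystem m n p)
    (k : ℕ) : (S.conj g).reachRank k = S.reachRank k := by
  rw [reachRank, reachSpan_conj hg]
  exact (Submodule.equivMapOfInjective _
    (Matrix.mulVec_injective_of_det_ne_zero hg) _).finrank_eq.symm

/-! ### Selected vectors -/

/-- The block of the `s`-th basis vector, as the index of an input. -/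
def input (I : MultiIndex n (m + n - 1)) (s : Fin n) : Fin m := ⟨I.block s, I.block_lt s⟩

/-- The number of the `s`-th basis vector within its block. -/
def offset (I : MultiIndex n (m + n - 1)) (s : Fin n) : ℕ := s - countBelow I.block (I.block s)

theorem countBelow_add_offset (I : MultiIndex n (m + n - 1)) (s : Fin n) :
    countBelow I.block (I.block s) + offset I s = s := by
  have : ¬ (s : ℕ) < countBelow I.block (I.block s) := fun h =>
    lt_irrefl _ ((lt_countBelow I.block_mono).1 h)
  rw [offset]
  omega

theorem countBelow_add_offset_lt (I : MultiIndex n (m + n - 1)) (s : Fin n) :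
    countBelow I.block (I.block s) + offset I s < countBelow I.block (I.block s + 1) := by
  rw [countBelow_add_offset]
  exact (lt_countBelow I.block_mono).2 (Nat.lt_succ_self _)

theorem exists_input_offset_eq (I : MultiIndex n (m + n - 1)) {k o : ℕ}
    (h : countBelow I.block k + o < countBelow I.block (k + 1)) :
    I.block ⟨countBelow I.block k + o, h.trans_le (countBelow_le _ _)⟩ = k ∧
      offset I ⟨countBelow I.block k + o, h.trans_le (countBelow_le _ _)⟩ = o := by
  set s : Fin n := ⟨countBelow I.block k + o, h.trans_le (countBelow_le _ _)⟩
  have h1 : I.block s < k + 1 := (lt_countBelow I.block_mono).1 h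
  have h2 : ¬ I.block s < k := fun hk => by
    have : countBelow I.block k + o < countBelow I.block k := (lt_countBelow I.block_mono).2 hk
    omega
  have h3 : I.block s = k := by omega
  refine ⟨h3, ?_⟩
  rw [offset, h3]
  simp [s]

/-- The square matrix whose columns are the vectors `bⱼ, A bⱼ, …, Aᵒ bⱼ` that a multi-index selects,
with `dⱼ` of them for the `j`-th input, where `dⱼ` is the size of the `j`-th block. -/
def selected (I : MultiIndex n (m + n - 1)) (S : LinearSystem m n p) :
    Matrix (Fin n) (Fin n) ℂ :=
  Matrix.of fun r s => S.reach (offset I s) (input I s) r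

theorem selected_col (I : MultiIndex n (m + n - 1)) (S : LinearSystem m n p) (s : Fin n) :
    (selected I S).col s = S.reach (offset I s) (input I s) := rfl

theorem selected_conj (I : MultiIndex n (m + n - 1)) {g : Matrix (Fin n) (Fin n) ℂ}
    (hg : g.det ≠ 0) (S : LinearSystem m n p) : selected I (S.conj g) = g * selected I S := by
  ext r s
  exact congrFun (reach_conj hg S (offset I s) (input I s)) r

theorem isCompletelyControllable_of_selected {I : MultiIndex n (m + n - 1)}
    {S : LinearSystem m n p} (h : (selected I S).det ≠ 0) : S.IsCompletelyControllable := by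
  rw [IsCompletelyControllable, Matrix.rank_eq_finrank_span_cols,
    finrank_eq_card_of_coordinate h (fun _ => True) (by simp) fun s _ => ?_]
  · simp
  · have : offset I s < n := (Nat.sub_le _ _).trans_lt s.2
    exact Submodule.subset_span ⟨(⟨offset I s, this⟩, input I s), rfl⟩

/-- A system that respects the coordinate subspaces of a multi-index, and whose selected vectors
are independent, has the ranks that belong to the multi-index. -/
theorem reachRank_eq_countBelow {I : MultiIndex n (m + n - 1)} {S : LinearSystem m n p}
    (h : (selected I S).det ≠ 0) (hA : ∀ s t, I.block t < I.block s → S.A s t = 0)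
    (hB : ∀ s (j : Fin m), (j : ℕ) < I.block s → S.B s j = 0) (k : ℕ) :
    S.reachRank k = countBelow I.block k := by
  have hreach : ∀ o (j : Fin m) s, (j : ℕ) < I.block s → S.reach o j s = 0 := by
    intro o j
    induction o with
    | zero =>
      intro s hs
      simpa [reach] using hB s j hs
    | succ o ih =>
      intro s hs
      rw [← mulVec_reach, Matrix.mulVec, dotProduct]
      refine Finset.sum_eq_zero fun t _ => ?_
      rcases lt_or_ge (I.block t) (I.block s) with ht | ht
      · rw [hA s t ht, zero_mul]
      · rw [ih t (hs.trans_le ht), mul_zero]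
  refine finrank_eq_card_of_coordinate h _ (fun v hv s hs => ?_) fun s hs =>
    S.reach_mem (offset I s) (j := input I s) hs
  induction hv using Submodule.span_induction with
  | mem v hv =>
    obtain ⟨⟨o, j, hj⟩, rfl⟩ := hv
    exact hreach o j s (hj.trans_le (not_lt.1 hs))
  | zero => rfl
  | add v w _ _ hv hw => rw [Pi.add_apply, hv, hw, add_zero]
  | smul c v _ hv => rw [Pi.smul_apply, hv, smul_zero]

/-- If the ranks of a system are those of a multi-index, the selected vectors span the reachable
subspaces. Modulo the subspace reachable from the previous inputs, the vectors `bⱼ, A bⱼ, A² bⱼ, …`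
are independent up to the first dependent one, and the later ones are dependent too. -/
theorem reachSpan_le_span_selected {I : MultiIndex n (m + n - 1)} {S : LinearSystem m n p}
    (h : ∀ k ≤ m, S.reachRank k = countBelow I.block k) {k : ℕ} (hk : k ≤ m) :
    S.reachSpan k ≤ Submodule.span ℂ ((selected I S).col '' {s | I.block s < k}) := by
  refine filtration_le_span S.reachSpan_zero (fun k hk => ?_) hk
  set j : Fin m := ⟨k, hk⟩
  have hle : S.reachSpan (k + 1) ≤ S.reachSpan k ⊔ Submodule.span ℂ ((fun o => S.reach o j) ''
      {o | o < countBelow I.block (k + 1) - countBelow I.block k}) := by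
    refine sup_span_eq_of_finrank (S.reachSpan_mono (Nat.le_succ k))
      (fun o => S.reach_mem o (Nat.lt_succ_self k)) (fun o ho => ?_) ?_
    · set F := S.reachSpan k ⊔ Submodule.span ℂ ((fun o => S.reach o j) '' {i | i < o}) with hF
      -- `F` is invariant: `A` maps each generator to the next one, and the last one to `Aᵒ bⱼ ∈ F`.
      have hinv : F ≤ F.comap S.A.mulVecLin := by
        refine sup_le (fun v hv => Submodule.mem_sup_left (S.mulVec_mem_reachSpan hv))
          (Submodule.span_le.2 ?_)
        rintro _ ⟨i, hi, rfl⟩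
        change S.A.mulVec (S.reach i j) ∈ F
        rw [mulVec_reach]
        rcases Nat.lt_or_ge (i + 1) o with hio | hio
        · exact Submodule.mem_sup_right (Submodule.subset_span ⟨i + 1, hio, rfl⟩)
        · rw [show i + 1 = o from le_antisymm hi hio]
          exact ho
      have hall : ∀ i, S.reach i j ∈ F := by
        intro i
        induction i with
        | zero =>
          rcases Nat.eq_zero_or_pos o with rfl | ho'
          · exact ho
          · exact Submodule.mem_sup_right (Submodule.subset_span ⟨0, ho', rfl⟩)
        | succ i ih =>
          rw [← mulVec_reach]
          exact hinv ih
      refine reachSpan_le fun i j' hj' => ?_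
      rcases Nat.lt_succ_iff_lt_or_eq.1 hj' with hj' | hj'
      · exact Submodule.mem_sup_left (S.reach_mem i hj')
      · rw [show j' = j from Fin.ext hj']
        exact hall i
    · have h1 := h k hk.le
      have h2 := h (k + 1) hk
      have := countBelow_mono I.block (Nat.le_succ k)
      rw [reachRank] at h1 h2
      rw [h1, h2]
      exact le_add_tsub
  refine hle.trans (sup_le_sup_left (Submodule.span_mono ?_) _)
  rintro _ ⟨o, ho, rfl⟩
  have ho' : countBelow I.block k + o < countBelow I.block (k + 1) := by
    rw [mem_ofPred_eq] at ho
    omega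
  obtain ⟨h1, h2⟩ := exists_input_offset_eq I ho'
  refine ⟨_, h1, ?_⟩
  rw [selected_col, h2]
  exact congrArg (S.reach o) (Fin.ext h1)

theorem det_selected_ne_zero {I : MultiIndex n (m + n - 1)} {S : LinearSystem m n p}
    (h : ∀ k ≤ m, S.reachRank k = countBelow I.block k) : (selected I S).det ≠ 0 := by
  have h1 := reachSpan_le_span_selected h le_rfl
  have h2 := h m le_rfl
  rw [countBelow_eq I.block_lt, reachRank] at h2
  rw [Submodule.eq_top_of_finrank_eq (h2.trans (Module.finrank_fin_fun ℂ).symm)] at h1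
  exact det_ne_zero_of_span_eq_top (h1.trans (Submodule.span_mono (image_subset_range _ _)))

/-! ### Normal forms -/

/-- The equivalent system whose selected vectors are the unit vectors. If the selected vectors are
dependent, it has no meaning. -/
def normalized (I : MultiIndex n (m + n - 1)) (S : LinearSystem m n p) : LinearSystem m n p :=
  S.conj (selected I S)⁻¹

theorem normalized_conj (I : MultiIndex n (m + n - 1)) {g : Matrix (Fin n) (Fin n) ℂ}
    (hg : g.det ≠ 0) (S : LinearSystem m n p) : normalized I (S.conj g) = normalized I S := by
  rw [normalized, selected_conj I hg, conj_conj, Matrix.mul_inv_rev, Matrix.mul_assoc,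
    Matrix.nonsing_inv_mul _ (isUnit_iff_ne_zero.2 hg), Matrix.mul_one, normalized]

theorem det_inv_ne_zero {g : Matrix (Fin n) (Fin n) ℂ} (hg : g.det ≠ 0) : g⁻¹.det ≠ 0 :=
  ((Matrix.isUnit_nonsing_inv_det_iff).2 (isUnit_iff_ne_zero.2 hg)).ne_zero

theorem selected_normalized {I : MultiIndex n (m + n - 1)} {S : LinearSystem m n p}
    (h : (selected I S).det ≠ 0) : selected I (normalized I S) = 1 := by
  rw [normalized, selected_conj I (det_inv_ne_zero h),
    Matrix.nonsing_inv_mul _ (isUnit_iff_ne_zero.2 h)]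

/-- The size of the `j`-th block. -/
def blockSize (I : MultiIndex n (m + n - 1)) (j : Fin m) : ℕ :=
  countBelow I.block (j + 1) - countBelow I.block j

/-- The free parameters of the normal forms: for each input `j` the coefficients of the first
dependent vector among `bⱼ, A bⱼ, A² bⱼ, …`, and the entries of `C`. -/
abbrev Coord (p : ℕ) (I : MultiIndex n (m + n - 1)) : Type :=
  {z : Fin n × Fin m // I.block z.1 ≤ z.2} ⊕ (Fin p × Fin n)

theorem card_coord (I : MultiIndex n (m + n - 1)) :
    Fintype.card (Coord p I) = schubertDim I + n * (p + 1) := by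
  have h : ∀ s, (Finset.univ.filter fun j : Fin m => I.block s ≤ j).card =
      (I.1ᶜ.filter fun c => I.elt s < c).card + 1 := fun s => by
    have h1 : (Finset.univ.filter fun j : Fin m => I.block s ≤ j) = Finset.Ici (input I s) := by
      ext j
      simp [input, Fin.le_def]
    have h2 := I.card_filter_notMem s
    have h3 := I.block_lt s
    have h4 := I.block_add s
    have h5 : (input I s : ℕ) = I.block s := rfl
    rw [h1, Fin.card_Ici, h5]
    omega
  rw [Fintype.card_sum, Fintype.card_subtype, Finset.card_filter, Fintype.sum_prod_type,
    I.schubertDim_eq_sum]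
  simp only [← Finset.card_filter, h, Finset.sum_add_distrib]
  simp
  ring

/-- The vectors `Aᵒ bⱼ` of a normal form, for `o` up to the size of the `j`-th block. -/
def normalVector (I : MultiIndex n (m + n - 1)) (x : Coord p I → ℂ) (j : Fin m) (o : ℕ) :
    Fin n → ℂ := fun s =>
  if countBelow I.block j + o < countBelow I.block (j + 1) then
    if (s : ℕ) = countBelow I.block j + o then 1 else 0
  else if h : I.block s ≤ j then x (Sum.inl ⟨(s, j), h⟩) else 0

/-- The system in normal form with given parameters. -/
def normalForm (I : MultiIndex n (m + n - 1)) (x : Coord p I → ℂ) : LinearSystem m n p where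
  A := Matrix.of fun r s => normalVector I x (input I s) (offset I s + 1) r
  B := Matrix.of fun r j => normalVector I x j 0 r
  C := Matrix.of fun i s => x (Sum.inr (i, s))

theorem normalVector_eq_zero (I : MultiIndex n (m + n - 1)) (x : Coord p I → ℂ) {j : Fin m}
    (o : ℕ) {s : Fin n} (h : (j : ℕ) < I.block s) : normalVector I x j o s = 0 := by
  rw [normalVector]
  split_ifs with h1 h2 h3
  · have := (lt_countBelow I.block_mono (s := s) (k := j + 1)).1 (h2 ▸ h1)
    omega
  · rfl
  · omega
  · rfl

theorem normalVector_input_offset (I : MultiIndex n (m + n - 1)) (x : Coord p I → ℂ) (r s : Fin n) :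
    normalVector I x (input I s) (offset I s) r = (1 : Matrix (Fin n) (Fin n) ℂ) r s := by
  have h := countBelow_add_offset_lt I s
  have h' : countBelow I.block (input I s) + offset I s = s := countBelow_add_offset I s
  refine (if_pos h).trans ?_
  rw [h', Matrix.one_apply]
  simp only [Fin.ext_iff]

theorem reach_normalForm (I : MultiIndex n (m + n - 1)) (x : Coord p I → ℂ) (j : Fin m) {o : ℕ}
    (h : countBelow I.block j + o ≤ countBelow I.block (j + 1)) :
    (normalForm I x).reach o j = normalVector I x j o := by
  induction o with
  | zero =>
    ext r
    simp [reach, normalForm]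
  | succ o ih =>
    obtain ⟨h1, h2⟩ := exists_input_offset_eq I (k := j) (o := o) h
    set s : Fin n := ⟨countBelow I.block j + o, Nat.lt_of_lt_of_le h (countBelow_le _ _)⟩
    have h3 : input I s = j := Fin.ext h1
    have h4 : normalVector I x j o = Pi.single s 1 := by
      ext r
      have := normalVector_input_offset I x r s
      rw [h2, h3] at this
      rw [this, Matrix.one_apply, Pi.single_apply]
    rw [← mulVec_reach, ih (Nat.le_of_succ_le h), h4, Matrix.mulVec_single_one]
    ext r
    change normalVector I x (input I s) (offset I s + 1) r = _
    rw [h2, h3]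

theorem selected_normalForm (I : MultiIndex n (m + n - 1)) (x : Coord p I → ℂ) :
    selected I (normalForm I x) = 1 := by
  ext r s
  have h := congrFun (reach_normalForm I x (input I s) (countBelow_add_offset_lt I s).le) r
  exact h.trans (normalVector_input_offset I x r s)

theorem det_selected_normalForm (I : MultiIndex n (m + n - 1)) (x : Coord p I → ℂ) :
    (selected I (normalForm I x)).det ≠ 0 := by
  rw [selected_normalForm, Matrix.det_one]
  exact one_ne_zero

theorem reachRank_normalForm (I : MultiIndex n (m + n - 1)) (x : Coord p I → ℂ) (k : ℕ) :
    (normalForm I x).reachRank k = countBelow I.block k :=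
  reachRank_eq_countBelow (det_selected_normalForm I x)
    (fun _ t h => normalVector_eq_zero I x (offset I t + 1) h)
    (fun _ _ h => normalVector_eq_zero I x 0 h) k

/-- The parameters of the normal form of a system. -/
def normalCoord (I : MultiIndex n (m + n - 1)) (S : LinearSystem m n p) : Coord p I → ℂ
  | Sum.inl z => (normalized I S).reach (blockSize I z.1.2) z.1.2 z.1.1
  | Sum.inr z => (normalized I S).C z.1 z.2

theorem normalized_normalForm (I : MultiIndex n (m + n - 1)) (x : Coord p I → ℂ) :
    normalized I (normalForm I x) = normalForm I x := by
  rw [normalized, selected_normalForm, inv_one]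
  simp [conj]

theorem normalCoord_normalForm (I : MultiIndex n (m + n - 1)) (x : Coord p I → ℂ) :
    normalCoord I (normalForm I x) = x := by
  ext (⟨⟨s, j⟩, h⟩ | ⟨i, s⟩)
  · have hle := countBelow_mono I.block (Nat.le_succ j)
    have h1 : countBelow I.block j + blockSize I j = countBelow I.block (j + 1) := by
      rw [blockSize]
      exact add_tsub_cancel_of_le hle
    simp only [normalCoord, normalized_normalForm]
    rw [reach_normalForm I x j h1.le, normalVector, h1, if_neg (lt_irrefl _), dif_pos h]
  · simp only [normalCoord, normalized_normalForm]
    rfl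

theorem eq_normalForm {I : MultiIndex n (m + n - 1)} {S : LinearSystem m n p}
    (h : ∀ k ≤ m, S.reachRank k = countBelow I.block k) :
    normalized I S = normalForm I (normalCoord I S) := by
  have hdet := det_selected_ne_zero h
  set S' := normalized I S with hS'
  have h' : ∀ k ≤ m, S'.reachRank k = countBelow I.block k := fun k hk => by
    rw [hS', normalized, reachRank_conj (det_inv_ne_zero hdet), h k hk]
  have hsel : selected I S' = 1 := selected_normalized hdet
  have key : ∀ (j : Fin m) (o : ℕ), countBelow I.block j + o ≤ countBelow I.block (j + 1) →
      S'.reach o j = normalVector I (normalCoord I S) j o := by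
    intro j o ho
    ext r
    rcases ho.lt_or_eq with hlt | heq
    · obtain ⟨h1, h2⟩ := exists_input_offset_eq I (k := j) (o := o) hlt
      set s : Fin n := ⟨countBelow I.block j + o, Nat.lt_of_lt_of_le hlt (countBelow_le _ _)⟩
      have h3 : input I s = j := Fin.ext h1
      have h4 := normalVector_input_offset I (normalCoord I S) r s
      rw [h2, h3] at h4
      rw [h4, ← hsel, ← h2]
      conv_lhs => rw [← h3]
      rfl
    · have ho' : o = blockSize I j := by rw [blockSize]; omega
      rw [normalVector, if_neg (by omega)]
      split_ifs with hr
      · rw [ho']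
        rfl
      · have h1 := reachSpan_le_span_selected h' (k := j + 1) j.2
          (S'.reach_mem o (Nat.lt_succ_self j))
        have h2 := inv_mulVec_apply_eq_zero (by rw [hsel, Matrix.det_one]; exact one_ne_zero) h1
          (s := r) (by omega)
        rwa [hsel, inv_one, Matrix.one_mulVec] at h2
  refine ext_of_eq ?_ ?_ rfl
  · ext r s
    have h1 := congrFun (key (input I s) (offset I s + 1) (countBelow_add_offset_lt I s)) r
    refine Eq.trans ?_ h1
    have h2 : S'.reach (offset I s) (input I s) = Pi.single s 1 := by
      have : (selected I S').col s = Pi.single s 1 := by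
        rw [hsel]
        ext t
        simp [Matrix.one_apply, Pi.single_apply]
      exact this
    rw [← mulVec_reach, h2, Matrix.mulVec_single_one]
    rfl
  · ext r j
    have h1 := congrFun (key j 0 (countBelow_mono _ (Nat.le_succ _))) r
    refine Eq.trans ?_ h1
    simp [reach]

end LinearSystem

/-! ### Invariant flags -/

section Flags

variable {n : ℕ}

/-- Between two different invariant subspaces there is one of the next dimension: an eigenvector in
the quotient spans it. -/
theorem exists_invariant_between {A : Matrix (Fin n) (Fin n) ℂ} {U U' : Submodule ℂ (Fin n → ℂ)}
    (hU : ∀ v ∈ U, A.mulVec v ∈ U) (hU' : ∀ v ∈ U', A.mulVec v ∈ U') (hlt : U < U') :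
    ∃ W, U ≤ W ∧ W ≤ U' ∧ (∀ v ∈ W, A.mulVec v ∈ W) ∧
      Module.finrank ℂ W = Module.finrank ℂ U + 1 := by
  let f : Module.End ℂ U' := A.mulVecLin.restrict hU'
  let K : Submodule ℂ U' := U.comap U'.subtype
  have hK : K ≠ ⊤ := fun h => hlt.not_ge fun v hv => by
    have : (⟨v, hv⟩ : U') ∈ K := h ▸ Submodule.mem_top
    exact this
  have : Nontrivial (U' ⧸ K) := Submodule.Quotient.nontrivial_iff.2 hK
  let fQ : Module.End ℂ (U' ⧸ K) := K.mapQ K f fun v hv => hU _ hv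
  obtain ⟨μ, hμ⟩ := Module.End.exists_eigenvalue fQ
  obtain ⟨w, hw⟩ := hμ.exists_hasEigenvector
  obtain ⟨u, rfl⟩ := Submodule.Quotient.mk_surjective K w
  have hu : (u : Fin n → ℂ) ∉ U := fun h => hw.2 ((Submodule.Quotient.mk_eq_zero K).2 h)
  have hAu : A.mulVec u - μ • (u : Fin n → ℂ) ∈ U := by
    have h1 : Submodule.Quotient.mk (f u) = (Submodule.Quotient.mk (μ • u) : U' ⧸ K) :=
      hw.apply_eq_smul
    exact (Submodule.Quotient.eq K).1 h1
  refine ⟨U ⊔ Submodule.span ℂ {(u : Fin n → ℂ)}, le_sup_left,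
    sup_le hlt.le (Submodule.span_le.2 (by simp)), fun v hv => ?_, ?_⟩
  · obtain ⟨a, ha, b, hb, rfl⟩ := Submodule.mem_sup.1 hv
    obtain ⟨c, rfl⟩ := Submodule.mem_span_singleton.1 hb
    rw [Matrix.mulVec_add, Matrix.mulVec_smul]
    refine add_mem (Submodule.mem_sup_left (hU a ha)) (Submodule.smul_mem _ _ ?_)
    rw [← sub_add_cancel (A.mulVec u) (μ • (u : Fin n → ℂ))]
    exact add_mem (Submodule.mem_sup_left hAu)
      (Submodule.mem_sup_right (Submodule.smul_mem _ _ (Submodule.mem_span_singleton_self _)))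
  · apply le_antisymm
    · exact (Submodule.finrank_add_le_finrank_add_finrank _ _).trans
        (Nat.add_le_add_left ((finrank_span_le_card _).trans (by simp)) _)
    · refine Submodule.finrank_lt_finrank_of_lt (lt_of_le_of_ne le_sup_left fun h => hu ?_)
      rw [h]
      exact Submodule.mem_sup_right (Submodule.mem_span_singleton_self _)

/-- A chain of invariant subspaces refines to a complete invariant flag. -/
theorem exists_invariant_flag {A : Matrix (Fin n) (Fin n) ℂ} {V : ℕ → Submodule ℂ (Fin n → ℂ)}
    (hV : Monotone V) (hA : ∀ k, ∀ v ∈ V k, A.mulVec v ∈ V k) {b : ℕ} (hb : V b = ⊤) :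
    ∃ F : ℕ → Submodule ℂ (Fin n → ℂ), Monotone F ∧ (∀ i, ∀ v ∈ F i, A.mulVec v ∈ F i) ∧
      (∀ i ≤ n, Module.finrank ℂ (F i) = i) ∧ ∀ k, V k ≤ F (Module.finrank ℂ (V k)) := by
  classical
  -- The flag is built upwards, each step inside the smallest `V k` of larger dimension.
  let P : ℕ → Submodule ℂ (Fin n → ℂ) → Prop := fun i F =>
    (∀ v ∈ F, A.mulVec v ∈ F) ∧ (i ≤ n → Module.finrank ℂ F = i) ∧
      ∀ k, i ≤ Module.finrank ℂ (V k) → F ≤ V k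
  have hstep : ∀ i F, P i F → ∃ F', F ≤ F' ∧ P (i + 1) F' := by
    rintro i F ⟨hF, hdim, hFV⟩
    by_cases hi : i < n
    · have hex : ∃ k, i < Module.finrank ℂ (V k) := ⟨b, by rw [hb]; simpa using hi⟩
      have hi' := Nat.find_spec hex
      have hlt : F < V (Nat.find hex) := lt_of_le_of_ne (hFV _ hi'.le) fun h => by
        rw [← h, hdim hi.le] at hi'
        exact lt_irrefl _ hi'
      obtain ⟨W, hFW, hWV, hW, hWdim⟩ := exists_invariant_between hF (hA _) hlt
      exact ⟨W, hFW, hW, fun _ => by rw [hWdim, hdim hi.le],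
        fun k hk => hWV.trans (hV (Nat.find_min' hex hk))⟩
    · refine ⟨F, le_rfl, hF, fun h => absurd h hi, fun k hk => ?_⟩
      have := Submodule.finrank_le (V k)
      rw [Module.finrank_fin_fun] at this
      omega
  choose next hle hnext using hstep
  let seq : (i : ℕ) → {F // P i F} := fun i => Nat.rec (motive := fun i => {F // P i F})
    ⟨⊥, fun v hv => by simp [(Submodule.mem_bot ℂ).1 hv], fun _ => finrank_bot _ _,
      fun _ _ => bot_le⟩ (fun i F => ⟨next i F.1 F.2, hnext i F.1 F.2⟩) i
  refine ⟨fun i => (seq i).1, monotone_nat_of_le_succ fun i => hle i (seq i).1 (seq i).2,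
    fun i => (seq i).2.1, fun i => (seq i).2.2.1, fun k => ?_⟩
  have hk : Module.finrank ℂ (V k) ≤ n := by
    simpa using Submodule.finrank_le (V k)
  exact (Submodule.eq_of_le_of_finrank_eq ((seq _).2.2.2 k le_rfl) ((seq _).2.2.1 hk)).ge

end Flags

namespace LinearSystem

variable {m n p : ℕ}

/-- A system is equivalent to one in triangular form whose reachable subspaces are coordinate
subspaces. -/
theorem exists_triangular {J : MultiIndex n (m + n - 1)} {S : LinearSystem m n p}
    (h : ∀ k ≤ m, S.reachRank k = countBelow J.block k) :
    ∃ g : Matrix (Fin n) (Fin n) ℂ, g.det ≠ 0 ∧ (∀ s t, t < s → (S.conj g).A s t = 0) ∧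
      ∀ s (j : Fin m), (j : ℕ) < J.block s → (S.conj g).B s j = 0 := by
  have htop : S.reachSpan m = ⊤ := by
    refine Submodule.eq_top_of_finrank_eq ?_
    rw [← reachRank, h m le_rfl, countBelow_eq J.block_lt, Module.finrank_fin_fun]
  obtain ⟨F, hF, hFA, hdim, hVF⟩ := exists_invariant_flag S.reachSpan_mono
    (fun k v hv => S.mulVec_mem_reachSpan hv) htop
  have hex : ∀ s : Fin n, ∃ v, v ∈ F (s + 1) ∧ v ∉ F s := fun s => by
    have hlt : F s < F (s + 1) := lt_of_le_of_ne (hF (Nat.le_succ _)) fun heq => by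
      have h1 := hdim s s.2.le
      rw [heq, hdim (s + 1) s.2] at h1
      omega
    exact SetLike.exists_of_lt hlt
  choose v hv hv' using hex
  let e : Matrix (Fin n) (Fin n) ℂ := Matrix.of fun r s => v s r
  have hspan : ∀ {i}, i ≤ n → F i ≤ Submodule.span ℂ (e.col '' {s | (s : ℕ) < i}) := by
    intro i hi
    refine filtration_le_span (Submodule.finrank_eq_zero.1 (hdim 0 (Nat.zero_le n)))
      (fun k hk => ?_) hi
    refine le_trans ?_ (sup_le_sup_left (Submodule.span_mono (s := {v ⟨k, hk⟩}) ?_) _)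
    · refine (Submodule.eq_of_le_of_finrank_le (sup_le (hF (Nat.le_succ k))
        (Submodule.span_le.2 (by simpa using hv ⟨k, hk⟩))) ?_).ge
      rw [hdim (k + 1) hk]
      have hlt : F k < F k ⊔ Submodule.span ℂ {v ⟨k, hk⟩} :=
        lt_of_le_of_ne le_sup_left fun heq => hv' ⟨k, hk⟩ (by
          change v ⟨k, hk⟩ ∈ F k
          rw [heq]
          exact Submodule.mem_sup_right (Submodule.mem_span_singleton_self _))
      have := Submodule.finrank_lt_finrank_of_lt hlt
      rwa [hdim k hk.le] at this
    · rintro _ rfl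
      exact ⟨⟨k, hk⟩, rfl, rfl⟩
  have he : e.det ≠ 0 := by
    have h1 := hspan le_rfl
    rw [Submodule.eq_top_of_finrank_eq ((hdim n le_rfl).trans (Module.finrank_fin_fun ℂ).symm)]
      at h1
    exact det_ne_zero_of_span_eq_top (h1.trans (Submodule.span_mono (image_subset_range _ _)))
  refine ⟨e⁻¹, det_inv_ne_zero he, fun s t hts => ?_, fun s j hj => ?_⟩
  · have h1 : (S.conj e⁻¹).A s t = e⁻¹.mulVec (S.A.mulVec (v t)) s := by
      rw [conj, Matrix.nonsing_inv_nonsing_inv _ (isUnit_iff_ne_zero.2 he), Matrix.mulVec_mulVec]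
      rfl
    rw [h1]
    exact inv_mulVec_apply_eq_zero he (hspan t.2 (hFA _ _ (hv t)))
      (by rw [Nat.lt_succ_iff]; exact not_le.2 hts)
  · have h1 : (S.conj e⁻¹).B s j = e⁻¹.mulVec (S.reach 0 j) s := by
      rw [reach, pow_zero, Matrix.one_mul]
      rfl
    have h2 := hVF (j + 1) (S.reach_mem 0 (Nat.lt_succ_self j))
    rw [← reachRank, h (j + 1) j.2] at h2
    rw [h1]
    refine inv_mulVec_apply_eq_zero he (hspan (countBelow_le _ _) h2) ?_
    rw [lt_countBelow J.block_mono]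
    omega

end LinearSystem

open LinearSystem

/-! ### The cells of the moduli space -/

section Cells

variable {m n p : ℕ}

theorem reach_mem_regOn {X : Type} {𝒳 : SpaceWithFunctions X} {U : Set X}
    {S : X → LinearSystem m n p} (hA : ∀ i j, (fun x => (S x).A i j) ∈ 𝒳.regOn U)
    (hB : ∀ i j, (fun x => (S x).B i j) ∈ 𝒳.regOn U) (o : ℕ) (j : Fin m) (r : Fin n) :
    (fun x => (S x).reach o j r) ∈ 𝒳.regOn U :=
  mul_apply_mem_regOn (pow_apply_mem_regOn hA o) hB r j

theorem ccSystem_A_mem_regOn (U : Set (CCSystem m n p)) (i j : Fin n) :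
    (fun S : CCSystem m n p => S.1.A i j) ∈ (ccSystemStr m n p).regOn U := fun S _ =>
  (isMorphism_induced _).comp_mem_regOn (coord_mem_regOn (Sum.inl (i, j))) S (mem_univ S)

theorem ccSystem_B_mem_regOn (U : Set (CCSystem m n p)) (i : Fin n) (j : Fin m) :
    (fun S : CCSystem m n p => S.1.B i j) ∈ (ccSystemStr m n p).regOn U := fun S _ =>
  (isMorphism_induced _).comp_mem_regOn (coord_mem_regOn (Sum.inr (Sum.inl (i, j)))) S
    (mem_univ S)

theorem ccSystem_C_mem_regOn (U : Set (CCSystem m n p)) (i : Fin p) (j : Fin n) :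
    (fun S : CCSystem m n p => S.1.C i j) ∈ (ccSystemStr m n p).regOn U := fun S _ =>
  (isMorphism_induced _).comp_mem_regOn (coord_mem_regOn (Sum.inr (Sum.inr (i, j)))) S
    (mem_univ S)

theorem isMorphism_mk :
    IsMorphism (ccSystemStr m n p) (sysCC m n p) (Quotient.mk (ccSetoid m n p)) :=
  isMorphism_coinduced _

theorem mk_eq_mk_of_conj {S S' : CCSystem m n p} {g : Matrix (Fin n) (Fin n) ℂ} (hg : g.det ≠ 0)
    (h : S'.1 = S.1.conj g) : Quotient.mk (ccSetoid m n p) S' = Quotient.mk (ccSetoid m n p) S :=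
  (Quotient.sound (s := ccSetoid m n p) (equivalent_iff.2 ⟨g, hg, h⟩)).symm

/-- The dimensions of the reachable subspaces, as functions on the moduli space. -/
def sysRank : SysCC m n p → ℕ → ℕ :=
  Quotient.lift (fun S : CCSystem m n p => S.1.reachRank) fun S S' h => by
    obtain ⟨g, hg, h'⟩ := equivalent_iff.1 h
    funext k
    rw [h', reachRank_conj hg]

/-- The cell of a multi-index in the moduli space of completely controllable systems. -/
def sysCell (p : ℕ) (I : MultiIndex n (m + n - 1)) : Set (SysCC m n p) :=
  rankStratum sysRank m (countBelow I.block)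

theorem isOpen_le_sysRank (k d : ℕ) :
    IsOpen[(sysCC m n p).top] {y | d ≤ sysRank y k} :=
  isOpen_le_finrank_span (𝒳 := ccSystemStr m n p)
    (u := fun S (z : ℕ × {j : Fin m // (j : ℕ) < k}) => S.1.reach z.1 z.2)
    (fun _ r => reach_mem_regOn (ccSystem_A_mem_regOn univ) (ccSystem_B_mem_regOn univ) _ _ r) d

theorem exists_mem_sysCell (y : SysCC m n p) : ∃ I, y ∈ sysCell (m := m) (n := n) p I := by
  obtain ⟨S, rfl⟩ := Quotient.exists_rep y
  obtain ⟨f, hf, hfm, hcount⟩ := exists_countBelow_eq (n := n) (b := m) (ρ := S.1.reachRank)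
    (by rw [reachRank, reachSpan_zero, finrank_bot])
    (fun k l hkl => Submodule.finrank_mono (S.1.reachSpan_mono hkl))
    (reachRank_eq_of_isCompletelyControllable S.2)
  obtain ⟨I, hI⟩ := MultiIndex.exists_block_eq hf hfm
  refine ⟨I, fun k hk => ?_⟩
  rw [show I.block = f from funext hI, hcount k hk]
  rfl

/-- The parameters of the normal form, as functions on the moduli space. -/
def sysCoord (I : MultiIndex n (m + n - 1)) : SysCC m n p → Coord p I → ℂ :=
  Quotient.lift (fun S : CCSystem m n p => normalCoord I S.1) fun S S' h => by
    obtain ⟨g, hg, h'⟩ := equivalent_iff.1 h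
    have : normalized I S'.1 = normalized I S.1 := by rw [h', normalized_conj I hg]
    funext z
    rcases z with z | z <;> simp only [normalCoord, this]

/-- The orbits of systems whose selected vectors are independent. -/
def sysChart (p : ℕ) (I : MultiIndex n (m + n - 1)) : Set (SysCC m n p) :=
  {y | Quotient.lift (fun S : CCSystem m n p => (selected I S.1).det ≠ 0) (fun S S' h => by
    obtain ⟨g, hg, h'⟩ := equivalent_iff.1 h
    rw [h', selected_conj I hg, Matrix.det_mul, mul_ne_zero_iff]
    exact propext (and_iff_right hg).symm) y}

theorem sysCell_subset_sysChart (I : MultiIndex n (m + n - 1)) : sysCell p I ⊆ sysChart p I := by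
  intro y hy
  obtain ⟨S, rfl⟩ := Quotient.exists_rep y
  exact det_selected_ne_zero hy

theorem selected_mem_regOn {X : Type} {𝒳 : SpaceWithFunctions X} {U : Set X}
    {S : X → LinearSystem m n p} (hA : ∀ i j, (fun x => (S x).A i j) ∈ 𝒳.regOn U)
    (hB : ∀ i j, (fun x => (S x).B i j) ∈ 𝒳.regOn U) (I : MultiIndex n (m + n - 1))
    (r s : Fin n) : (fun x => selected I (S x) r s) ∈ 𝒳.regOn U :=
  reach_mem_regOn hA hB (offset I s) (input I s) r

theorem sysCoord_mem_regOn (I : MultiIndex n (m + n - 1)) (z : Coord p I) :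
    (fun y => sysCoord I y z) ∈ (sysCC m n p).regOn (sysChart p I) := by
  set U : Set (CCSystem m n p) := {S | (selected I S.1).det ≠ 0}
  have hsel : ∀ (U : Set (CCSystem m n p)) r s,
      (fun S : CCSystem m n p => selected I S.1 r s) ∈ (ccSystemStr m n p).regOn U := fun U r s =>
    selected_mem_regOn (ccSystem_A_mem_regOn U) (ccSystem_B_mem_regOn U) I r s
  have hinv : ∀ r s, (fun S : CCSystem m n p => (selected I S.1)⁻¹ r s) ∈
      (ccSystemStr m n p).regOn U := inv_apply_mem_regOn (hsel U) fun _ h => h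
  have hinv' : ∀ r s, (fun S : CCSystem m n p => ((selected I S.1)⁻¹)⁻¹ r s) ∈
      (ccSystemStr m n p).regOn U := inv_apply_mem_regOn hinv fun _ h => det_inv_ne_zero h
  refine mem_regOn_coinduced (𝒳 := ccSystemStr m n p) (q := Quotient.mk (ccSetoid m n p))
    (T := sysChart p I) (f := fun y => sysCoord I y z) (isOpen_ne_zero (det_mem_regOn (hsel univ)))
    (?_ : (fun S : CCSystem m n p => normalCoord I S.1 z) ∈ (ccSystemStr m n p).regOn U)
  rcases z with z | z
  · exact reach_mem_regOn (S := fun S : CCSystem m n p => normalized I S.1)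
      (mul_apply_mem_regOn (mul_apply_mem_regOn hinv (ccSystem_A_mem_regOn U)) hinv')
      (mul_apply_mem_regOn hinv (ccSystem_B_mem_regOn U)) _ _ _
  · exact mul_apply_mem_regOn (ccSystem_C_mem_regOn U) hinv' z.1 z.2

/-- The normal form as a completely controllable system. -/
def normalSystem (I : MultiIndex n (m + n - 1)) (x : Coord p I → ℂ) : CCSystem m n p :=
  ⟨normalForm I x, isCompletelyControllable_of_selected (det_selected_normalForm I x)⟩

theorem isMorphism_normalSystem (I : MultiIndex n (m + n - 1)) :
    IsMorphism (affine (Coord p I)) (ccSystemStr m n p) (normalSystem I) := by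
  have hvec : ∀ j o s, (fun x : Coord p I → ℂ => normalVector I x j o s) ∈
      (affine (Coord p I)).regOn univ := by
    intro j o s
    unfold normalVector
    split_ifs with h1 h2 h3
    · exact const_mem_regOn _ _
    · exact const_mem_regOn _ _
    · exact coord_mem_regOn _
    · exact const_mem_regOn _ _
  refine isMorphism_to_induced (isMorphism_affine ?_)
  rintro (⟨r, s⟩ | ⟨r, j⟩ | ⟨i, s⟩)
  · exact hvec _ _ _
  · exact hvec _ _ _
  · exact coord_mem_regOn (Sum.inr (i, s) : Coord p I)

/-- A cell of the moduli space is an affine space: its coordinates are the parameters of the normal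
form. -/
def sysCellIso (I : MultiIndex n (m + n - 1)) :
    Iso ((sysCC m n p).sub (sysCell p I)) (affine (Coord p I)) where
  toEquiv :=
    { toFun := fun y => sysCoord I y.1
      invFun := fun x => ⟨Quotient.mk (ccSetoid m n p) (normalSystem I x),
        fun k _ => reachRank_normalForm I x k⟩
      left_inv := by
        rintro ⟨y, hy⟩
        obtain ⟨S, rfl⟩ := Quotient.exists_rep y
        exact Subtype.ext (mk_eq_mk_of_conj (det_inv_ne_zero (det_selected_ne_zero hy))
          (eq_normalForm hy).symm)
      right_inv := fun x => normalCoord_normalForm I x }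
  isMorphism := isMorphism_affine fun z =>
    restrict_mem_regOn (sysCell_subset_sysChart I) (sysCoord_mem_regOn I z)
  isMorphism_symm := isMorphism_to_induced (isMorphism_mk.comp (isMorphism_normalSystem I))

theorem nonempty_sysCell_iso (I : MultiIndex n (m + n - 1)) :
    Nonempty (Iso ((sysCC m n p).sub (sysCell p I))
      (affine (Fin (schubertDim I + n * (p + 1))))) :=
  ⟨(sysCellIso I).trans (affineReindex (Fintype.equivFinOfCardEq (card_coord I)))⟩

/-- The projection of the space of systems to the linear subspace of the systems that respect the
coordinate subspaces of a multi-index. -/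
def blockTriangular (I : MultiIndex n (m + n - 1))
    (w : (Fin n × Fin n) ⊕ (Fin n × Fin m) ⊕ (Fin p × Fin n) → ℂ) : LinearSystem m n p where
  A := Matrix.of fun s t => if I.block t < I.block s then 0 else w (Sum.inl (s, t))
  B := Matrix.of fun s j => if (j : ℕ) < I.block s then 0 else w (Sum.inr (Sum.inl (s, j)))
  C := Matrix.of fun i s => w (Sum.inr (Sum.inr (i, s)))

theorem blockTriangular_coords {I : MultiIndex n (m + n - 1)} {S : LinearSystem m n p}
    (hA : ∀ s t, I.block t < I.block s → S.A s t = 0)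
    (hB : ∀ s (j : Fin m), (j : ℕ) < I.block s → S.B s j = 0) :
    blockTriangular I S.coords = S := by
  refine ext_of_eq (Matrix.ext fun s t => ?_) (Matrix.ext fun s j => ?_) rfl
  · by_cases h : I.block t < I.block s
    · simp [blockTriangular, h, hA s t h]
    · simp [blockTriangular, h, coords]
  · by_cases h : (j : ℕ) < I.block s
    · simp [blockTriangular, h, hB s j h]
    · simp [blockTriangular, h, coords]

/-- Every orbit in the smaller cell is a limit of orbits in the larger cell: the systems that
respect the coordinate subspaces of `I` form a vector space, which contains the triangular
representatives of the smaller cell, and whose generic elements lie in the cell of `I`. -/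
theorem sysCell_subset_closure {I J : MultiIndex n (m + n - 1)}
    (h : ∀ s, I.block s ≤ J.block s) :
    sysCell p J ⊆ (sysCC m n p).closure (sysCell p I) := by
  intro y hy
  obtain ⟨S, rfl⟩ := Quotient.exists_rep y
  obtain ⟨g, hg, hA, hB⟩ := exists_triangular hy
  have hS' : (S.1.conj g).IsCompletelyControllable :=
    isCompletelyControllable_of_selected (I := J) (det_selected_ne_zero fun k hk => by
      rw [reachRank_conj hg]; exact hy k hk)
  rw [← mk_eq_mk_of_conj (S' := ⟨_, hS'⟩) hg rfl]
  refine isMorphism_mk.map_mem_closure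
    (S := Quotient.mk (ccSetoid m n p) ⁻¹' sysCell p I) (fun _ hM => hM) ?_
  have hregA : ∀ i j, (fun w => (blockTriangular (p := p) I w).A i j) ∈ (affine _).regOn univ := by
    intro i j
    by_cases hij : I.block j < I.block i
    · simpa [blockTriangular, hij] using const_mem_regOn _ _
    · simpa [blockTriangular, hij] using coord_mem_regOn _
  have hregB : ∀ i j, (fun w => (blockTriangular (p := p) I w).B i j) ∈ (affine _).regOn univ := by
    intro i j
    by_cases hij : (j : ℕ) < I.block i
    · simpa [blockTriangular, hij] using const_mem_regOn _ _
    · simpa [blockTriangular, hij] using coord_mem_regOn _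
  refine mem_closure_induced (Γ := fun w => (blockTriangular I w).coords) (isMorphism_affine ?_)
    (G := {w | (selected I (blockTriangular I w)).det ≠ 0})
    (isOpen_ne_zero (det_mem_regOn (selected_mem_regOn hregA hregB I))) ?_ (fun w hw => ?_)
    (w := (S.1.conj g).coords) ?_
  · rintro (⟨i, j⟩ | ⟨i, j⟩ | ⟨i, j⟩)
    · exact hregA i j
    · exact hregB i j
    · exact coord_mem_regOn (Sum.inr (Sum.inr (i, j)))
  · refine ⟨(normalForm I (0 : Coord p I → ℂ)).coords, ?_⟩
    rw [mem_ofPred_eq, blockTriangular_coords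
      (fun _ t h => normalVector_eq_zero I 0 (offset I t + 1) h)
      (fun _ _ h => normalVector_eq_zero I 0 0 h)]
    exact det_selected_normalForm I 0
  · refine ⟨⟨_, isCompletelyControllable_of_selected hw⟩, fun k _ => ?_, rfl⟩
    refine reachRank_eq_countBelow hw (fun s t hst => ?_) (fun s j hj => ?_) k
    · simp [blockTriangular, hst]
    · simp [blockTriangular, hj]
  · refine congrArg coords (blockTriangular_coords (fun s t hst => hA s t ?_)
      fun s j hj => hB s j (hj.trans_le (h s)))
    exact not_le.1 fun hts => absurd (I.block_mono hts) (not_le.2 hst)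

end Cells

/-! ### Vector bundles -/

namespace VectorFamily

variable {B : Type} {𝓑 : SpaceWithFunctions B} {r : ℕ}

/-- The trivial vector bundle. -/
def trivialBundle (𝓑 : SpaceWithFunctions B) (r : ℕ) : VectorFamily B where
  Fiber _ := Fin r → ℂ
  total := (𝓑.prod (affine (Fin r))).induced fun z => (z.1, z.2)

theorem isTrivialOver_trivialBundle (S : Set B) : (trivialBundle 𝓑 r).IsTrivialOver 𝓑 r S := by
  have hval : IsMorphism ((trivialBundle 𝓑 r).total.sub ((trivialBundle 𝓑 r).part S))
      (𝓑.prod (affine (Fin r))) fun z => (z.1.1, z.1.2) :=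
    (isMorphism_induced _).comp (isMorphism_subtype_val _)
  have hsnd := isMorphism_snd.comp hval
  refine ⟨⟨⟨fun z => (⟨z.1.1, z.2⟩, z.1.2), fun z => ⟨⟨z.1.1, z.2⟩, z.1.2⟩, fun _ => rfl,
    fun _ => rfl⟩, isMorphism_prod (isMorphism_to_induced (isMorphism_fst.comp hval))
      hsnd,
    isMorphism_to_induced (isMorphism_to_induced (isMorphism_prod
      ((isMorphism_subtype_val S).comp isMorphism_fst) isMorphism_snd))⟩, fun _ => rfl,
    fun b _ => ⟨fun _ _ => rfl, fun _ _ => rfl⟩⟩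

theorem isVectorBundle_trivialBundle : (trivialBundle 𝓑 r).IsVectorBundle 𝓑 r :=
  ⟨isMorphism_fst.comp (isMorphism_induced _), fun b => ⟨univ, @isOpen_univ _ 𝓑.top, mem_univ b,
    isTrivialOver_trivialBundle univ⟩⟩

/-- The projection of a vector bundle is an open map. -/
theorem isOpen_image_proj {E : VectorFamily B} (hE : E.IsVectorBundle 𝓑 r)
    {W : Set (Σ b, E.Fiber b)} (hW : IsOpen[E.total.top] W) :
    IsOpen[𝓑.top] (Sigma.fst '' W) := by
  refine (@isOpen_iff_forall_mem_open _ 𝓑.top _).2 ?_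
  rintro _ ⟨z, hz, rfl⟩
  obtain ⟨U, hU, hzU, e, he, -⟩ := hE.2 z.1
  have hO := isOpen_image_fst (e.isMorphism_symm.isOpen_preimage
    ((isMorphism_subtype_val (E.part U)).isOpen_preimage hW))
  obtain ⟨O, hO, hO'⟩ := hO
  refine ⟨O ∩ U, ?_, @IsOpen.inter _ 𝓑.top _ _ hO hU, ?_, hzU⟩
  · rintro b ⟨hbO, hbU⟩
    have hb : (⟨b, hbU⟩ : U) ∈ Subtype.val ⁻¹' O := hbO
    rw [hO'] at hb
    obtain ⟨y, hy, hyb⟩ := hb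
    refine ⟨(e.toEquiv.symm y).1, hy, ?_⟩
    rw [← he, Equiv.apply_symm_apply, hyb]
  · have h1 : (e.toEquiv ⟨z, hzU⟩).1 ∈ Subtype.val ⁻¹' O := by
      rw [hO']
      refine ⟨_, ?_, rfl⟩
      rw [mem_preimage, Equiv.symm_apply_apply]
      exact hz
    rw [← he ⟨z, hzU⟩]
    exact h1

theorem part_subset_closure {E : VectorFamily B} (hE : E.IsVectorBundle 𝓑 r) {S T : Set B}
    (h : T ⊆ 𝓑.closure S) : E.part T ⊆ E.total.closure (E.part S) := by
  intro z hz
  refine (@mem_closure_iff _ E.total.top _ _).2 fun W hW hzW => ?_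
  obtain ⟨_, ⟨y, hy, rfl⟩, hyS⟩ := (@mem_closure_iff _ 𝓑.top _ _).1 (h hz) _
    (isOpen_image_proj hE hW) ⟨z, hzW, rfl⟩
  exact ⟨y, hy, hyS⟩

theorem nonempty_part_iso {E : VectorFamily B} {S : Set B} (hE : E.IsTrivialOver 𝓑 r S) {d : ℕ}
    (e : Iso (𝓑.sub S) (affine (Fin d))) :
    Nonempty (Iso (E.total.sub (E.part S)) (affine (Fin (d + r)))) := by
  obtain ⟨f, -⟩ := hE
  exact ⟨((f.trans (e.prodLeft _)).trans (affineProd _ _)).trans (affineReindex finSumFinEquiv)⟩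

end VectorFamily

theorem theorem3 (m n p : ℕ) (hmn : 1 ≤ m + n) :
    ∃ C : MultiIndex n (m + n - 1) → Set (SysCC m n p),
      (sysCC m n p).IsCellDecomposition C (fun I => schubertDim I + n * (p + 1)) ∧
      (∃ E : VectorFamily (Gras n (m + n - 1)),
        E.IsVectorBundle (gras n (m + n - 1)) (n * (p + 1)) ∧
        ∀ I, E.IsTrivialOver (gras n (m + n - 1)) (n * (p + 1)) (schubertCell I)) ∧
      ∀ E : VectorFamily (Gras n (m + n - 1)),
        E.IsVectorBundle (gras n (m + n - 1)) (n * (p + 1)) →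
        (∀ I, E.IsTrivialOver (gras n (m + n - 1)) (n * (p + 1)) (schubertCell I)) →
        E.total.IsCellDecomposition (fun I => E.part (schubertCell I))
            (fun I => schubertDim I + n * (p + 1)) ∧
        (sysCC m n p).IdenticalCells C E.total (fun I => E.part (schubertCell I)) := by
  have hblock : ∀ (I : MultiIndex n (m + n - 1)) s, I.block s ≤ m := fun I s => (I.block_lt s).le
  have hpos : ∀ (I : MultiIndex n (m + n - 1)) s, I.pos s ≤ m + n - 1 := fun I s =>
    (I.elt s).2.le
  have hcl : ∀ I J : MultiIndex n (m + n - 1), (∀ s, J.block s ≤ I.block s) →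
      sysCell p I ⊆ (sysCC m n p).closure (sysCell p J) := fun I J h => sysCell_subset_closure h
  have hsys := nonempty_sysCell_iso (m := m) (n := n) (p := p)
  have hne : ∀ I : MultiIndex n (m + n - 1), (sysCell p I).Nonempty := fun I =>
    ⟨_, ((sysCellIso I).toEquiv.symm 0).2⟩
  refine ⟨sysCell p, isCellDecomposition_rankStratum MultiIndex.block_mono hblock
    isOpen_le_sysRank exists_mem_sysCell hcl (fun I J hIJ h => ?_) hsys,
    ⟨VectorFamily.trivialBundle _ _, VectorFamily.isVectorBundle_trivialBundle,
      fun I => VectorFamily.isTrivialOver_trivialBundle _⟩, fun E hE htriv => ?_⟩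
  · exact Nat.add_lt_add_right (MultiIndex.schubertDim_lt hIJ fun s =>
      (MultiIndex.block_le_block_iff s).1 (h s)) _
  let ρ : (Σ W, E.Fiber W) → ℕ → ℕ := fun z => grasRank z.1
  have hpart : (fun I => E.part (schubertCell I)) =
      fun I : MultiIndex n (m + n - 1) => rankStratum ρ (m + n - 1) (countBelow I.pos) := by
    funext I
    rw [schubertCell_eq_rankStratum]
    rfl
  have hρ : ∀ k d, IsOpen[E.total.top] {z | d ≤ ρ z k} := fun k d =>
    hE.1.isOpen_preimage (isOpen_le_grasRank k d)
  have hEcl : ∀ I J : MultiIndex n (m + n - 1), (∀ s, J.pos s ≤ I.pos s) →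
      rankStratum ρ (m + n - 1) (countBelow I.pos) ⊆
        E.total.closure (rankStratum ρ (m + n - 1) (countBelow J.pos)) := fun I J h => by
    rw [← congrFun hpart I, ← congrFun hpart J]
    exact VectorFamily.part_subset_closure hE (schubertCell_subset_closure h)
  have hcell : ∀ I : MultiIndex n (m + n - 1), Nonempty (Iso (E.total.sub
      (rankStratum ρ (m + n - 1) (countBelow I.pos)))
        (affine (Fin (schubertDim I + n * (p + 1))))) := fun I => by
    rw [← congrFun hpart I]
    obtain ⟨e⟩ := nonempty_schubertCell_iso I
    exact VectorFamily.nonempty_part_iso (htriv I) e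
  have hcover : ∀ z, ∃ I : MultiIndex n (m + n - 1),
      z ∈ rankStratum ρ (m + n - 1) (countBelow I.pos) := fun z => by
    obtain ⟨I, hI⟩ := exists_mem_schubertCell z.1
    rw [schubertCell_eq_rankStratum] at hI
    exact ⟨I, hI⟩
  have hEne : ∀ I : MultiIndex n (m + n - 1),
      (rankStratum ρ (m + n - 1) (countBelow I.pos)).Nonempty := fun I => by
    obtain ⟨e⟩ := hcell I
    exact ⟨_, (e.toEquiv.symm 0).2⟩
  rw [hpart]
  refine ⟨isCellDecomposition_rankStratum (fun I => I.pos_strictMono.monotone) hpos hρ hcover hEcl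
    (fun I J hIJ h => Nat.add_lt_add_right (MultiIndex.schubertDim_lt hIJ h) _) hcell,
    fun I => ?_, fun I J => ?_⟩
  · obtain ⟨e⟩ := hsys I
    obtain ⟨e'⟩ := hcell I
    exact ⟨e.trans e'.symm⟩
  · refine (rankStratum_subset_closure_iff MultiIndex.block_mono hblock isOpen_le_sysRank hne hcl
      I J).trans (Iff.trans ?_ (rankStratum_subset_closure_iff
        (fun I => I.pos_strictMono.monotone) hpos hρ hEne hEcl I J).symm)
    exact forall_congr' fun s => MultiIndex.block_le_block_iff s

end
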